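/- **Setting.** Let $n$ be the number of vehicles; all indices $i,j$ range over $1,\dots,n$. Let $0<R_{in}<R_{out}$, $v_{\max}>0$, $\omega^*\in(0,v_{\max}/R_{out})$, $\Theta\in(0,\pi/2)$ with $\cos\Theta>R_{out}\omega^*/v_{\max}$, $\sigma_i>0$, $p_{i,j}=p_{j,i}>0$, $L_{i,j}=L_{j,i}>0$ ($i\ne j$), $\lambda>0$ with $\lambda>L_{i,j}$ for all $i\neq j$, $A>0$, $b>1/R_{in}^2$, $\mu_1,\mu_2>0$. For $i\neq j$ let $V_{i,j}:(L_{i,j},\infty)\to[0,\infty)$ be $C^2$ and $\kappa_{i,j}:(L_{i,j},\infty)\to[0,\infty)$ be $C^1$, with $V_{i,j}=V_{j,i}$, $\kappa_{i,j}=\kappa_{j,i}$, $V_{i,j}(d)=\kappa_{i,j}(d)=0$ for $d\ge\lambda$ and $V_{i,j}(d)\to+\infty$ as $d\to L_{i,j}^+$. Let $U_i:(R_{in},R_{out})\to[0,\infty)$ be $C^2$ with $U_i(r)\to+\infty$ as $r\to R_{in}^+$ and as $r\to R_{out}^-$. Let $g_1,g_2:\mathbb R\to\mathbb R$ be $C^1$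 and non-decreasing, and let $f:\mathbb R\to[0,\infty)$ be $C^1$ with $f(x)\ge\max(0,x)$ for all $x$. For a state $w=(r_i,\varphi_i,s_i,v_i)_{i=1}^n\in\mathbb R^{4n}$ put $d_{i,j}=\sqrt{p_{i,j}(r_i-r_j)^2+2r_ir_j(1-\cos(\varphi_i-\varphi_j))}$ and let $$\Omega=\{w:\ r_i\in(R_{in},R_{out}),\ s_i\in(-\Theta,\Theta),\ v_i\in(0,v_{\max})\text{ for all } i,\ d_{i,j}>L_{i,j}\text{ for all } i\ne j\}.$$ For $w\in\Omega$ define $$H(w)=\tfrac12\sum_i\Big(\tfrac{v_i}{r_i}\cos s_i-\omega^*\Big)^2+\tfrac b2\sum_i v_i^2\sin^2 s_i+\sum_iU_i(r_i)+\tfrac12\sum_i\sum_{j\ne i}V_{i,j}(d_{i,j})+A\sum_i\Big(\tfrac1{\cos s_i-\cos\Theta}-\tfrac1{1-\cos\Theta}\Big),$$ $$a(r,s,v)=\Big(b-\tfrac1{r^2}\Big)v^2\cos s+\omega^*\tfrac vr+\tfrac{A}{(\cos s-\cos\Theta)^2},$$ $$\Lambda_i=\Big(\tfrac{v_i}{r_i}\cos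 s_i-\omega^*\Big)\tfrac{v_i\cos s_i}{r_i^2}-U_i'(r_i)-\sum_{j\ne i}\big(p_{i,j}(r_i-r_j)+r_j(1-\cos(\varphi_i-\varphi_j))\big)\tfrac{V_{i,j}'(d_{i,j})}{d_{i,j}},$$ $$\Phi_i=\tfrac{r_i}{\omega^*}\sum_{j\ne i}V_{i,j}'(d_{i,j})\tfrac{r_j\sin(\varphi_i-\varphi_j)}{d_{i,j}},\qquad G_i=\tfrac1{\omega^*}\sum_{j\ne i}\kappa_{i,j}(d_{i,j})\Big(g_1\big(\tfrac{v_j}{r_j}\cos s_j\big)-g_1\big(\tfrac{v_i}{r_i}\cos s_i\big)\Big),$$ $$M_i=\sum_{j\ne i}\kappa_{i,j}(d_{i,j})\big(g_2(\sin s_j)-g_2(\sin s_i)\big),$$ $$k_i=\mu_1+\Phi_i-G_i+f\Big(-\tfrac{v_{\max}\cos s_i}{v_{\max}\cos s_i-r_i\omega^*}(\Phi_i-G_i)\Big),$$ and the Newtonian cruise controller $$F_i=-k_i\Big(v_i-\tfrac{r_i\omega^*}{\cos s_i}\Big)-\tfrac{r_i\omega^*}{\cos s_i}(\Phi_i-G_i),$$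 $$\delta_i=\arctan\Big(\tfrac{\sigma_i}{r_i}\cos s_i-\tfrac{\sigma_i}{v_i\,a(r_i,s_i,v_i)}\big(\mu_2\sin s_i+(bF_i\sin s_i+\Lambda_i)v_i-M_i\big)\Big).$$ The closed-loop system on $\Omega$ is the polar bicycle model with these feedback laws: $$\dot r_i=-v_i\sin s_i,\quad \dot\varphi_i=\tfrac{v_i}{r_i}\cos s_i,\quad \dot s_i=\tfrac{v_i}{\sigma_i}\tan\delta_i-\tfrac{v_i}{r_i}\cos s_i,\quad \dot v_i=F_i .$$ **Theorem 1.** There exists a non-decreasing function $P_1:[0,\infty)\to[0,\infty)$ such that for every $w_0\in\Omega$ the closed-loop system with $w(0)=w_0$ has a solution $w(t)$ defined for all $t\ge0$ with $w(t)\in\Omega$ for all $t\ge 0$; it is unique, in the sense that every solution in $\Omega$ on an interval $[0,T)$, $T>0$, with the same initial value coincides with $w$ on $[0,T)$. (In particular there are no collisions and no boundary violations, the speeds stay in $(0,v_{\max})$, and $|s_i|<\Theta$.) Moreover, for all $i$, as $t\to+\infty$, $$s_i(t)\to0,\qquad \frac{v_i(t)}{r_i(t)}\to\omega^*,\qquad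 \dot s_i(t)\to0,\qquad F_i(t)\to0,$$ and $$|F_i(t)|+|\delta_i(t)|\le P_1(H(w_0))\qquad\text{for all }t\ge0\text{ and all }i .$$ -/

import Mathlib

open Set Filter Topology

noncomputable section

namespace RingRoad

/-- The state `w = (r, φ, s, v)` of `n` vehicles: radii, angular coordinates, relative
orientations and speeds. -/
abbrev State (n : ℕ) : Type :=
  (Fin n → ℝ) × (Fin n → ℝ) × (Fin n → ℝ) × (Fin n → ℝ)

namespace State

variable {n : ℕ}

/-- Radii. -/
abbrev r (w : State n) : Fin n → ℝ := w.1

/-- Angular coordinates. -/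
abbrev φ (w : State n) : Fin n → ℝ := w.2.1

/-- Relative orientations. -/
abbrev s (w : State n) : Fin n → ℝ := w.2.2.1

/-- Speeds. -/
abbrev v (w : State n) : Fin n → ℝ := w.2.2.2

end State

/-- The data of the ring-road, of the vehicles, and of the Newtonian cruise controller.
Functions that are only given on an interval are represented by total functions; only their
values on that interval are constrained (see `Params.Admissible`) or used on the state space. -/
structure Params (n : ℕ) where
  /-- inner radius -/
  Rin : ℝ
  /-- outer radius -/
  Rout : ℝ
  /-- speed limit -/
  vmax : ℝ
  /-- angular speed set-point -/
  ω : ℝ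
  /-- maximal deviation of the heading angle from the tangent of the ring-road -/
  Θ : ℝ
  /-- vehicle lengths -/
  σ : Fin n → ℝ
  /-- weights of the inter-vehicle distance -/
  p : Fin n → Fin n → ℝ
  /-- minimal inter-vehicle distances -/
  L : Fin n → Fin n → ℝ
  /-- interaction range -/
  lam : ℝ
  /-- inter-vehicle potentials, on `(L i j, ∞)` -/
  V : Fin n → Fin n → ℝ → ℝ
  /-- boundary potentials, on `(Rin, Rout)` -/
  U : Fin n → ℝ → ℝ
  /-- viscosity coefficients, on `(L i j, ∞)` -/
  κ : Fin n → Fin n → ℝ → ℝ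
  g₁ : ℝ → ℝ
  g₂ : ℝ → ℝ
  f : ℝ → ℝ
  A : ℝ
  b : ℝ
  μ₁ : ℝ
  μ₂ : ℝ

namespace Params

variable {n : ℕ}

/-- The standing assumptions on the parameters. -/
structure Admissible (P : Params n) : Prop where
  Rin_pos : 0 < P.Rin
  Rin_lt_Rout : P.Rin < P.Rout
  vmax_pos : 0 < P.vmax
  ω_pos : 0 < P.ω
  ω_lt : P.ω < P.vmax / P.Rout
  Θ_pos : 0 < P.Θ
  Θ_lt : P.Θ < Real.pi / 2
  cos_Θ : P.Rout * P.ω / P.vmax < Real.cos P.Θ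
  σ_pos : ∀ i, 0 < P.σ i
  p_pos : ∀ i j, 0 < P.p i j
  p_symm : ∀ i j, P.p i j = P.p j i
  L_pos : ∀ i j, i ≠ j → 0 < P.L i j
  L_symm : ∀ i j, i ≠ j → P.L i j = P.L j i
  lam_pos : 0 < P.lam
  L_lt_lam : ∀ i j, i ≠ j → P.L i j < P.lam
  V_contDiff : ∀ i j, i ≠ j → ContDiffOn ℝ 2 (P.V i j) (Ioi (P.L i j))
  V_nonneg : ∀ i j, i ≠ j → ∀ d ∈ Ioi (P.L i j), 0 ≤ P.V i j d
  V_tendsto : ∀ i j, i ≠ j → Tendsto (P.V i j) (𝓝[>] (P.L i j)) atTop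
  V_eq_zero : ∀ i j, i ≠ j → ∀ d, P.lam ≤ d → P.V i j d = 0
  V_symm : ∀ i j, i ≠ j → ∀ d ∈ Ioi (P.L i j), P.V i j d = P.V j i d
  U_contDiff : ∀ i, ContDiffOn ℝ 2 (P.U i) (Ioo P.Rin P.Rout)
  U_nonneg : ∀ i, ∀ r ∈ Ioo P.Rin P.Rout, 0 ≤ P.U i r
  U_tendsto_in : ∀ i, Tendsto (P.U i) (𝓝[>] P.Rin) atTop
  U_tendsto_out : ∀ i, Tendsto (P.U i) (𝓝[<] P.Rout) atTop
  κ_contDiff : ∀ i j, i ≠ j → ContDiffOn ℝ 1 (P.κ i j) (Ioi (P.L i j))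
  κ_nonneg : ∀ i j, i ≠ j → ∀ d ∈ Ioi (P.L i j), 0 ≤ P.κ i j d
  κ_symm : ∀ i j, i ≠ j → ∀ d ∈ Ioi (P.L i j), P.κ i j d = P.κ j i d
  κ_eq_zero : ∀ i j, i ≠ j → ∀ d, P.lam ≤ d → P.κ i j d = 0
  g₁_contDiff : ContDiff ℝ 1 P.g₁
  g₁_mono : Monotone P.g₁
  g₂_contDiff : ContDiff ℝ 1 P.g₂
  g₂_mono : Monotone P.g₂
  f_contDiff : ContDiff ℝ 1 P.f
  le_f : ∀ x, max 0 x ≤ P.f x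
  A_pos : 0 < P.A
  lt_b : 1 / P.Rin ^ 2 < P.b
  μ₁_pos : 0 < P.μ₁
  μ₂_pos : 0 < P.μ₂

variable (P : Params n)

/-- The (weighted) distance `d_{i,j}` between vehicles `i` and `j`. -/
def dist (w : State n) (i j : Fin n) : ℝ :=
  √(P.p i j * (w.r i - w.r j) ^ 2
    + 2 * w.r i * w.r j * (1 - Real.cos (w.φ i - w.φ j)))

/-- The open state space `Ω`. -/
def Ω : Set (State n) :=
  {w | (∀ i, w.r i ∈ Ioo P.Rin P.Rout) ∧ (∀ i, w.s i ∈ Ioo (-P.Θ) P.Θ) ∧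
    (∀ i, w.v i ∈ Ioo 0 P.vmax) ∧ ∀ i j, j ≠ i → P.L i j < P.dist w i j}

/-- The control Lyapunov function `H`. -/
def H (w : State n) : ℝ :=
  (1 / 2) * ∑ i, (w.v i / w.r i * Real.cos (w.s i) - P.ω) ^ 2
    + P.b / 2 * ∑ i, w.v i ^ 2 * Real.sin (w.s i) ^ 2
    + ∑ i, P.U i (w.r i)
    + (1 / 2) * ∑ i, ∑ j ∈ Finset.univ.erase i, P.V i j (P.dist w i j)
    + P.A * ∑ i, (1 / (Real.cos (w.s i) - Real.cos P.Θ) - 1 / (1 - Real.cos P.Θ))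

/-- The function `a(r, s, v)`. -/
def a (r s v : ℝ) : ℝ :=
  (P.b - 1 / r ^ 2) * v ^ 2 * Real.cos s + P.ω * (v / r)
    + P.A / (Real.cos s - Real.cos P.Θ) ^ 2

/-- The function `Λ_i(w)`. -/
def Lam (w : State n) (i : Fin n) : ℝ :=
  (w.v i / w.r i * Real.cos (w.s i) - P.ω) * (w.v i * Real.cos (w.s i) / w.r i ^ 2)
    - deriv (P.U i) (w.r i)
    - ∑ j ∈ Finset.univ.erase i,
        (P.p i j * (w.r i - w.r j) + w.r j * (1 - Real.cos (w.φ i - w.φ j)))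
          * (deriv (P.V i j) (P.dist w i j) / P.dist w i j)

/-- The function `Φ_i(w)`. -/
def Phi (w : State n) (i : Fin n) : ℝ :=
  w.r i / P.ω * ∑ j ∈ Finset.univ.erase i,
    deriv (P.V i j) (P.dist w i j) * (w.r j * Real.sin (w.φ i - w.φ j) / P.dist w i j)

/-- The viscous term `G_i(w)`. -/
def G (w : State n) (i : Fin n) : ℝ :=
  1 / P.ω * ∑ j ∈ Finset.univ.erase i, P.κ i j (P.dist w i j)
    * (P.g₁ (w.v j / w.r j * Real.cos (w.s j)) - P.g₁ (w.v i / w.r i * Real.cos (w.s i)))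

/-- The viscous term `M_i(w)`. -/
def M (w : State n) (i : Fin n) : ℝ :=
  ∑ j ∈ Finset.univ.erase i, P.κ i j (P.dist w i j)
    * (P.g₂ (Real.sin (w.s j)) - P.g₂ (Real.sin (w.s i)))

/-- The state-dependent gain `k_i(w)`. -/
def k (w : State n) (i : Fin n) : ℝ :=
  P.μ₁ + P.Phi w i - P.G w i
    + P.f (-(P.vmax * Real.cos (w.s i) / (P.vmax * Real.cos (w.s i) - w.r i * P.ω))
        * (P.Phi w i - P.G w i))

/-- The acceleration `F_i(w)` commanded by the Newtonian cruise controller. -/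
def F (w : State n) (i : Fin n) : ℝ :=
  -P.k w i * (w.v i - w.r i * P.ω / Real.cos (w.s i))
    - w.r i * P.ω / Real.cos (w.s i) * (P.Phi w i - P.G w i)

/-- The steering angle `δ_i(w)` commanded by the Newtonian cruise controller. -/
def δ (w : State n) (i : Fin n) : ℝ :=
  Real.arctan (P.σ i / w.r i * Real.cos (w.s i)
    - P.σ i / (w.v i * P.a (w.r i) (w.s i) (w.v i))
      * (P.μ₂ * Real.sin (w.s i)
          + (P.b * P.F w i * Real.sin (w.s i) + P.Lam w i) * w.v i - P.M w i))

/-- The right-hand side of the polar bicycle model at the state `w`, for given accelerations `F`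
and steering angles `δ`. -/
def bicycle (w : State n) (F δ : Fin n → ℝ) : State n :=
  (fun i => -w.v i * Real.sin (w.s i),
   fun i => w.v i / w.r i * Real.cos (w.s i),
   fun i => w.v i / P.σ i * Real.tan (δ i) - w.v i / w.r i * Real.cos (w.s i),
   fun i => F i)

/-- `w` is a solution, on the time interval `I`, of the polar bicycle model in closed loop with the
Newtonian cruise controller. As the feedback is given on `Ω` only, solutions take values there. -/
def IsSolutionOn (I : Set ℝ) (w : ℝ → State n) : Prop :=
  ∀ t ∈ I, w t ∈ P.Ω ∧
    HasDerivWithinAt w (P.bicycle (w t) (P.F (w t)) (P.δ (w t))) I t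

end Params

end RingRoad

end

/-!
Write `ω_i = v_i cos s_i / r_i`. The function `H` is a Lyapunov function: along the closed loop its
derivative is at most `-∑ (μ₁ (ω_i - ω*)² + μ₂ sin² s_i)`, since the elastic forces of each pair of
vehicles cancel and the viscous ones are dissipative. As `H` blows up at the boundary of `Ω`, except
where a speed reaches `0` or `vmax`, trajectories keep away from that part of the boundary and `k`
is bounded along them. The choice of `k` gives, with `c_i = r_i ω* / cos s_i`,
`μ₁ c_i - k_i v_i ≤ F_i ≤ k_i (vmax - v_i) - μ₁ (vmax - c_i)`, so the speeds keep away from `0` and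
`vmax` as well. The region that is left is compact up to translations of the angles `φ_i` by full
turns, under which the closed loop is invariant; hence solutions are global, and continuous feedback
is bounded and uniformly continuous along them. Barbalat's lemma, applied to `H`, then to `s_i` and
`v_i / r_i`, gives the limits.
-/

namespace RingRoad

section ODE

variable {E : Type*} [NormedAddCommGroup E] [NormedSpace ℝ E] {X : E → E} {Ω K : Set E}

theorem hasDerivWithinAt_Ici_of_Icc {f : ℝ → E} {f' : E} {a b t : ℝ}
    (hf : HasDerivWithinAt f f' (Icc a b) t) (ht : t ∈ Ico a b) :
    HasDerivWithinAt f f' (Ici t) t :=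
  hf.mono_of_mem_nhdsWithin
    (mem_of_superset (Icc_mem_nhdsGE ht.2) (Icc_subset_Icc_left ht.1))

theorem locallyLipschitzOn_of_contDiffOn (hΩ : IsOpen Ω)
    (hX : ContDiffOn ℝ 1 X Ω) : LocallyLipschitzOn Ω X := fun x hx => by
  obtain ⟨C, s, hs, hC⟩ := (hX.contDiffAt (hΩ.mem_nhds hx)).exists_lipschitzOnWith
  exact ⟨C, s, mem_nhdsWithin_of_mem_nhds hs, hC⟩

theorem eqOn_Icc_of_isIntegralCurveOn (hX : LocallyLipschitzOn Ω X) {a b : ℝ} {w y : ℝ → E}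
    (hw : IsIntegralCurveOn w (fun _ => X) (Icc a b)) (hwΩ : MapsTo w (Icc a b) Ω)
    (hy : IsIntegralCurveOn y (fun _ => X) (Icc a b)) (hyΩ : MapsTo y (Icc a b) Ω)
    (hwy : w a = y a) : EqOn w y (Icc a b) := by
  set K := w '' Icc a b ∪ y '' Icc a b
  have hK : IsCompact K :=
    (isCompact_Icc.image_of_continuousOn hw.continuousOn).union
      (isCompact_Icc.image_of_continuousOn hy.continuousOn)
  have hKΩ : K ⊆ Ω := union_subset hwΩ.image_subset hyΩ.image_subset
  obtain ⟨C, hC⟩ := (hX.mono hKΩ).exists_lipschitzOnWith_of_compact hK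
  exact ODE_solution_unique_of_mem_Icc_right (v := fun _ => X) (s := fun _ => K)
    (fun _ _ => hC)
    hw.continuousOn (fun t ht => hasDerivWithinAt_Ici_of_Icc (hw t (Ico_subset_Icc_self ht)) ht)
    (fun t ht => Or.inl (mem_image_of_mem w (Ico_subset_Icc_self ht)))
    hy.continuousOn (fun t ht => hasDerivWithinAt_Ici_of_Icc (hy t (Ico_subset_Icc_self ht)) ht)
    (fun t ht => Or.inr (mem_image_of_mem y (Ico_subset_Icc_self ht))) hwy

theorem mapsTo_Icc_of_forall_mapsTo {α R : Type*} [TopologicalSpace α]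
    [ConditionallyCompleteLinearOrder R] [TopologicalSpace R] [OrderTopology R]
    [DenselyOrdered R] {w : R → α} {a b : R} {K W : Set α} (hw : ContinuousOn w (Icc a b))
    (ha : w a ∈ K) (hK : IsClosed K) (hW : IsOpen W) (hKW : K ⊆ W)
    (h : ∀ t ∈ Icc a b, MapsTo w (Icc a t) W → w t ∈ K) :
    MapsTo w (Icc a b) K := by
  suffices hmaps : MapsTo w (Icc a b) W from
    fun t ht => h t ht (hmaps.mono_left (Icc_subset_Icc_right ht.2))
  by_contra hexit
  set exits := Icc a b ∩ w ⁻¹' Wᶜ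
  have h_exits : IsClosed exits :=
    hw.preimage_isClosed_of_isClosed isClosed_Icc hW.isClosed_compl
  have h_exits_bdd : BddBelow exits := bddBelow_Icc.mono inter_subset_left
  obtain ⟨hτ, hτW⟩ : sInf exits ∈ exits := by
    simp only [MapsTo, not_forall] at hexit
    obtain ⟨t, ht, htW⟩ := hexit
    exact h_exits.csInf_mem ⟨t, ht, htW⟩ h_exits_bdd
  have hbefore : MapsTo w (Ico a (sInf exits)) K := fun t ht => by
    have htab : t ∈ Icc a b := ⟨ht.1, ht.2.le.trans hτ.2⟩
    refine h t htab fun q hq => by_contra fun hqW => ?_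
    exact (hq.2.trans_lt ht.2).not_ge (csInf_le h_exits_bdd ⟨⟨hq.1, hq.2.trans htab.2⟩, hqW⟩)
  have haτ : a ≠ sInf exits := fun he => hτW (he ▸ hKW ha)
  have hτcl : sInf exits ∈ closure (Ico a (sInf exits)) := by
    rw [closure_Ico haτ]
    exact right_mem_Icc.2 hτ.1
  have hwτ : ContinuousWithinAt w (Ico a (sInf exits)) (sInf exits) :=
    (hw _ hτ).mono fun t ht => ⟨ht.1, ht.2.le.trans hτ.2⟩
  exact hτW (hKW (hK.closure_eq ▸ hwτ.mem_closure hτcl hbefore))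

variable [FiniteDimensional ℝ E]

theorem exists_lipschitz_eqOn_of_isCompact (hΩ : IsOpen Ω) (hX : ContDiffOn ℝ 1 X Ω)
    (hK : IsCompact K) (hKΩ : K ⊆ Ω) :
    ∃ (Y : E → E) (W : Set E) (C B : NNReal), IsOpen W ∧ K ⊆ W ∧ W ⊆ Ω ∧ EqOn Y X W ∧
      LipschitzWith C Y ∧ ∀ x, ‖Y x‖ ≤ B := by
  obtain ⟨S, hS, hKS, hSΩ⟩ := exists_compact_between hK hΩ hKΩ
  obtain ⟨S', hS', hSS', hS'Ω⟩ := exists_compact_between hS hΩ hSΩ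
  obtain ⟨χ, χ_smooth, -, χ_supp, hχ⟩ :=
    exists_contMDiff_support_eq_eq_one_iff (n := 1) (modelWithCornersSelf ℝ E) isOpen_interior
      hS.isClosed hSS'
  have hts : tsupport χ ⊆ S' := by
    rw [tsupport, χ_supp]
    exact closure_minimal interior_subset hS'.isClosed
  have hsupp : HasCompactSupport (fun x => χ x • X x) :=
    HasCompactSupport.smul_right (HasCompactSupport.of_support_subset_isCompact hS'
      (subset_closure.trans hts))
  have hY : ContDiff ℝ 1 (fun x => χ x • X x) := by
    refine contDiff_iff_contDiffAt.2 fun x => ?_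
    by_cases hx : x ∈ tsupport χ
    · exact χ_smooth.contDiff.contDiffAt.smul (hX.contDiffAt (hΩ.mem_nhds (hS'Ω (hts hx))))
    · refine contDiffAt_const (c := (0 : E)) |>.congr_of_eventuallyEq ?_
      filter_upwards [notMem_tsupport_iff_eventuallyEq.1 hx] with z hz
      simp [hz]
  obtain ⟨C, hC⟩ := hY.lipschitzWith_of_hasCompactSupport (𝕂 := ℝ) hsupp one_ne_zero
  obtain ⟨B, hB⟩ := hsupp.exists_bound_of_continuous hY.continuous
  refine ⟨_, interior S, C, B.toNNReal, isOpen_interior, hKS, interior_subset.trans hSΩ,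
    fun x hx => ?_, hC, fun x => (hB x).trans B.le_coe_toNNReal⟩
  simp [(hχ x).1 (interior_subset hx)]

theorem exists_isIntegralCurveOn_Icc (hΩ : IsOpen Ω) (hX : ContDiffOn ℝ 1 X Ω) {x₀ : E} {T : ℝ}
    (hT : 0 ≤ T) (hK : IsCompact K) (hKΩ : K ⊆ Ω) (hx₀ : x₀ ∈ K)
    (apriori : ∀ t ∈ Icc 0 T, ∀ y : ℝ → E, y 0 = x₀ →
      IsIntegralCurveOn y (fun _ => X) (Icc 0 t) → MapsTo y (Icc 0 t) Ω → y t ∈ K) :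
    ∃ w : ℝ → E, w 0 = x₀ ∧ IsIntegralCurveOn w (fun _ => X) (Icc 0 T) ∧
      MapsTo w (Icc 0 T) Ω := by
  obtain ⟨Y, W, C, B, hW, hKW, hWΩ, hYX, hC, hB⟩ :=
    exists_lipschitz_eqOn_of_isCompact hΩ hX hK hKΩ
  have hPL : IsPicardLindelof (fun _ => Y) (⟨0, left_mem_Icc.2 hT⟩ : Icc 0 T) x₀
      (B * ⟨T, hT⟩) 0 B C :=
    .of_time_independent (fun x _ => hB x) hC.lipschitzOnWith (by simp [hT]; rfl)
  obtain ⟨w, hw₀ : w 0 = x₀, hw⟩ := hPL.exists_eq_forall_mem_Icc_hasDerivWithinAt₀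
  have hw_of_mapsTo : ∀ t ∈ Icc 0 T, MapsTo w (Icc 0 t) W →
      IsIntegralCurveOn w (fun _ => X) (Icc 0 t) := fun t ht h s hs => by
    have hs' := (hw s ⟨hs.1, hs.2.trans ht.2⟩).mono (Icc_subset_Icc_right ht.2)
    rwa [hYX (h hs)] at hs'
  have hwK : MapsTo w (Icc 0 T) K := by
    refine mapsTo_Icc_of_forall_mapsTo (fun t ht => (hw t ht).continuousWithinAt)
      (hw₀ ▸ hx₀) hK.isClosed hW hKW fun t ht h => ?_
    exact apriori t ht w hw₀ (hw_of_mapsTo t ht h) (h.mono_right hWΩ)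
  exact ⟨w, hw₀, hw_of_mapsTo T (right_mem_Icc.2 hT) (hwK.mono_right hKW), hwK.mono_right hKΩ⟩

theorem exists_isIntegralCurveOn_Ici (hΩ : IsOpen Ω) (hX : ContDiffOn ℝ 1 X Ω) {x₀ : E}
    (hx₀ : x₀ ∈ Ω) (apriori : ∀ T, 0 ≤ T → ∃ K : Set E, IsCompact K ∧ K ⊆ Ω ∧
      ∀ t ∈ Icc 0 T, ∀ y : ℝ → E, y 0 = x₀ →
        IsIntegralCurveOn y (fun _ => X) (Icc 0 t) → MapsTo y (Icc 0 t) Ω → y t ∈ K) :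
    ∃ w : ℝ → E, w 0 = x₀ ∧ IsIntegralCurveOn w (fun _ => X) (Ici 0) ∧ MapsTo w (Ici 0) Ω := by
  have hex : ∀ N : ℕ, ∃ w : ℝ → E, w 0 = x₀ ∧
      IsIntegralCurveOn w (fun _ => X) (Icc 0 N) ∧ MapsTo w (Icc 0 N) Ω := fun N => by
    obtain ⟨K, hK, hKΩ, h⟩ := apriori N N.cast_nonneg
    exact exists_isIntegralCurveOn_Icc hΩ hX N.cast_nonneg (hK.insert x₀)
      (insert_subset hx₀ hKΩ) (mem_insert _ _) fun t ht y hy₀ hy hyΩ =>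
        Or.inr (h t ht y hy₀ hy hyΩ)
  choose u hu₀ hu huΩ using hex
  have hglue : ∀ N : ℕ, EqOn (fun t => u ⌈t⌉₊ t) (u N) (Icc 0 N) := fun N t ht => by
    have hceil : Icc 0 t ⊆ Icc 0 (⌈t⌉₊ : ℝ) := Icc_subset_Icc_right (Nat.le_ceil t)
    have hN : Icc 0 t ⊆ Icc 0 (N : ℝ) := Icc_subset_Icc_right ht.2
    exact eqOn_Icc_of_isIntegralCurveOn (locallyLipschitzOn_of_contDiffOn hΩ hX)
      ((hu _).mono hceil) ((huΩ _).mono_left hceil) ((hu N).mono hN) ((huΩ N).mono_left hN)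
      ((hu₀ _).trans (hu₀ N).symm) (right_mem_Icc.2 ht.1)
  refine ⟨fun t => u ⌈t⌉₊ t, hu₀ _, fun t ht => ?_,
    fun t ht => huΩ _ ⟨ht, Nat.le_ceil t⟩⟩
  obtain ⟨N, hN⟩ := exists_nat_gt t
  have htN : t ∈ Icc 0 (N : ℝ) := ⟨ht, hN.le⟩
  have hderiv : HasDerivWithinAt (fun t => u ⌈t⌉₊ t) (X (u ⌈t⌉₊ t)) (Icc 0 N) t := by
    have h := (hu N t htN).congr (hglue N) (hglue N htN)
    rwa [← hglue N htN] at h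
  refine hderiv.mono_of_mem_nhdsWithin ?_
  rw [← Ici_inter_Iic]
  exact inter_mem_nhdsWithin _ (Iic_mem_nhds hN)

end ODE

section Analysis

theorem tendsto_zero_of_tendsto_of_uniformContinuousOn {E : Type*} [NormedAddCommGroup E]
    [NormedSpace ℝ E] {x x' : ℝ → E} {l : E} {a : ℝ}
    (hx : ∀ t ∈ Ici a, HasDerivWithinAt x (x' t) (Ici a) t) (hl : Tendsto x atTop (𝓝 l))
    (hx' : UniformContinuousOn x' (Ici a)) : Tendsto x' atTop (𝓝 0) := by
  rw [Metric.tendsto_atTop]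
  intro ε hε
  obtain ⟨d, hd, hx'd⟩ := Metric.uniformContinuousOn_iff_le.1 hx' (ε / 4) (by positivity)
  obtain ⟨N, hN⟩ := Metric.tendsto_atTop.1 hl (ε * d / 4) (by positivity)
  refine ⟨max N a, fun t ht => ?_⟩
  obtain ⟨htN, hta⟩ := max_le_iff.1 ht
  have hmem : ∀ s ∈ Icc t (t + d), s ∈ Ici a := fun s hs => hta.trans hs.1
  have hremainder : ‖(x (t + d) - (t + d) • x' t) - (x t - t • x' t)‖ ≤ ε / 4 * ‖t + d - t‖ := by
    refine (convex_Icc t (t + d)).norm_image_sub_le_of_norm_hasDerivWithin_le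
      (f' := fun s => x' s - (1 : ℝ) • x' t)
      (fun s hs => ((hx s (hmem s hs)).mono hmem).sub
        ((hasDerivWithinAt_id s _).smul_const (x' t))) (fun s hs => ?_)
      (left_mem_Icc.2 (by linarith)) (right_mem_Icc.2 (by linarith))
    rw [one_smul, ← dist_eq_norm]
    refine hx'd s (hmem s hs) t hta ?_
    rw [Real.dist_eq, abs_of_nonneg] <;> linarith [hs.1, hs.2]
  have hincrement : ‖x (t + d) - x t‖ ≤ ε * d / 4 + ε * d / 4 := by
    rw [← dist_eq_norm]
    exact (dist_triangle_right _ _ l).trans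
      (add_le_add (hN _ (by linarith)).le (hN t htN).le)
  have hsplit : d • x' t = (x (t + d) - x t)
      - ((x (t + d) - (t + d) • x' t) - (x t - t • x' t)) := by
    rw [add_smul]; abel
  have hnorm : d * ‖x' t‖ ≤ (ε * d / 4 + ε * d / 4) + ε / 4 * d := by
    rw [add_sub_cancel_left, Real.norm_of_nonneg hd.le] at hremainder
    calc d * ‖x' t‖ = ‖d • x' t‖ := by rw [norm_smul, Real.norm_of_nonneg hd.le]
      _ ≤ _ := hsplit ▸ (norm_sub_le _ _).trans (add_le_add hincrement hremainder)
  rw [dist_zero_right]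
  nlinarith

theorem exists_tendsto_of_antitoneOn_Ici {x : ℝ → ℝ} {a : ℝ} (hx : AntitoneOn x (Ici a))
    (hbdd : BddBelow (x '' Ici a)) : ∃ l, Tendsto x atTop (𝓝 l) := by
  have hanti : Antitone fun t => x (max a t) := fun s t hst =>
    hx (le_max_left a s) (le_max_left a t) (max_le_max_left a hst)
  have hrange : range (fun t => x (max a t)) ⊆ x '' Ici a :=
    range_subset_iff.2 fun t => mem_image_of_mem x (le_max_left a t)
  refine ⟨_, (tendsto_atTop_ciInf hanti (hbdd.mono hrange)).congr' ?_⟩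
  filter_upwards [eventually_ge_atTop a] with t ht
  rw [max_eq_right ht]

theorem tendsto_zero_of_mul_sq_le {α : Type*} {l : Filter α} {x y : α → ℝ} {c : ℝ} (hc : 0 < c)
    (hle : ∀ᶠ t in l, c * x t ^ 2 ≤ y t) (hy : Tendsto y l (𝓝 0)) : Tendsto x l (𝓝 0) := by
  have hsq : Tendsto (fun t => x t ^ 2) l (𝓝 0) := by
    refine squeeze_zero' (.of_forall fun t => sq_nonneg _)
      (hle.mono fun t ht => (le_div_iff₀' hc).2 ht) ?_
    simpa only [zero_div] using hy.div_const c
  rw [tendsto_zero_iff_abs_tendsto_zero]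
  simpa only [Real.sqrt_zero, Function.comp_def, Real.sqrt_sq_eq_abs] using
    (Real.continuous_sqrt.tendsto 0).comp hsq

theorem le_of_forall_eq_deriv_neg {f f' : ℝ → ℝ} {a b c : ℝ}
    (hf : ∀ t ∈ Icc a b, HasDerivWithinAt f (f' t) (Icc a b) t) (ha : f a ≤ c)
    (h : ∀ t ∈ Icc a b, f t = c → f' t < 0) : ∀ t ∈ Icc a b, f t ≤ c :=
  image_le_of_deriv_right_lt_deriv_boundary (B := fun _ => c) (B' := fun _ => 0)
    (fun t ht => (hf t ht).continuousWithinAt)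
    (fun t ht => hasDerivWithinAt_Ici_of_Icc (hf t (Ico_subset_Icc_self ht)) ht) ha
    (fun _ => hasDerivAt_const _ _) fun t ht => h t (Ico_subset_Icc_self ht)

theorem le_of_forall_eq_deriv_pos {f f' : ℝ → ℝ} {a b c : ℝ}
    (hf : ∀ t ∈ Icc a b, HasDerivWithinAt f (f' t) (Icc a b) t) (ha : c ≤ f a)
    (h : ∀ t ∈ Icc a b, f t = c → 0 < f' t) : ∀ t ∈ Icc a b, c ≤ f t := fun t ht =>
  neg_le_neg_iff.1 <| le_of_forall_eq_deriv_neg (fun s hs => (hf s hs).fun_neg)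
    (neg_le_neg ha) (fun s hs hfs => neg_neg_of_pos (h s hs (neg_injective hfs))) t ht

theorem exists_monotone_forall_le {α : Type*} {s : Set α} {h g : α → ℝ}
    (hg : ∀ c, BddAbove (g '' {x ∈ s | h x ≤ c})) :
    ∃ P : ℝ → ℝ, Monotone P ∧ (∀ c, 0 ≤ P c) ∧ ∀ x ∈ s, g x ≤ P (h x) := by
  have hbdd : ∀ c, BddAbove (insert 0 (g '' {x ∈ s | h x ≤ c})) := fun c => (hg c).insert 0
  refine ⟨fun c => sSup (insert 0 (g '' {x ∈ s | h x ≤ c})), fun c c' hc => ?_,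
    fun c => le_csSup (hbdd c) (mem_insert _ _), fun x hx => ?_⟩
  · refine csSup_le_csSup (hbdd c') (insert_nonempty _ _) (insert_subset_insert ?_)
    exact image_mono fun x hx => ⟨hx.1, hx.2.trans hc⟩
  · exact le_csSup (hbdd _) (mem_insert_of_mem _ (mem_image_of_mem g ⟨hx, le_rfl⟩))

theorem isClosed_sublevel_of_tendsto_atTop {α : Type*} [TopologicalSpace α] {D : Set α}
    {f : α → ℝ} (hf : ContinuousOn f D) (hD : ∀ x ∉ D, Tendsto f (𝓝[D] x) atTop) (c : ℝ) :
    IsClosed {x ∈ D | f x ≤ c} := by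
  refine isClosed_of_closure_subset fun x hx => ?_
  have : NeBot (𝓝[{x ∈ D | f x ≤ c}] x) := mem_closure_iff_nhdsWithin_neBot.1 hx
  have hle : ∀ᶠ y in 𝓝[{x ∈ D | f x ≤ c}] x, f y ≤ c :=
    eventually_mem_nhdsWithin.mono fun y hy => hy.2
  have hmono : 𝓝[{x ∈ D | f x ≤ c}] x ≤ 𝓝[D] x := nhdsWithin_mono x fun y hy => hy.1
  by_cases hxD : x ∈ D
  · exact ⟨hxD, le_of_tendsto ((hf x hxD).mono_left hmono) hle⟩
  · obtain ⟨y, hy, hy'⟩ :=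
      (hle.and (((hD x hxD).mono_left hmono).eventually_gt_atTop c)).exists
    exact absurd hy hy'.not_ge

theorem tendsto_nhdsWithin_Ioi_of_le {α : Type*} {l : Filter α} {f : ℝ → α} {a x : ℝ}
    (hf : Tendsto f (𝓝[>] a) l) (hx : x ≤ a) : Tendsto f (𝓝[Ioi a] x) l := by
  rcases hx.eq_or_lt with rfl | hx
  · exact hf
  · have : 𝓝[Ioi a] x = ⊥ := by
      rw [← notMem_closure_iff_nhdsWithin_eq_bot, closure_Ioi]
      exact hx.not_ge
    exact this ▸ tendsto_bot

theorem tendsto_nhdsWithin_Iio_of_ge {α : Type*} {l : Filter α} {f : ℝ → α} {a x : ℝ}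
    (hf : Tendsto f (𝓝[<] a) l) (hx : a ≤ x) : Tendsto f (𝓝[Iio a] x) l := by
  rcases hx.eq_or_lt with rfl | hx
  · exact hf
  · have : 𝓝[Iio a] x = ⊥ := by
      rw [← notMem_closure_iff_nhdsWithin_eq_bot, closure_Iio]
      exact hx.not_ge
    exact this ▸ tendsto_bot

theorem tendsto_nhdsWithin_atTop_of_comp_le {α : Type*} [TopologicalSpace α] {D : Set α} {x : α}
    {h u : α → ℝ} {f : ℝ → ℝ} {t : Set ℝ} (hu : Continuous u) (hut : MapsTo u D t)
    (hf : Tendsto f (𝓝[t] u x) atTop) (hle : ∀ y ∈ D, f (u y) ≤ h y) :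
    Tendsto h (𝓝[D] x) atTop :=
  tendsto_atTop_mono' _ (eventually_mem_nhdsWithin.mono hle)
    (hf.comp (hu.continuousWithinAt.tendsto_nhdsWithin hut))

section Translation

variable {E F : Type*} [SeminormedAddCommGroup E] [ProperSpace E] [SeminormedAddCommGroup F]
  {S B Γ : Set E} {f : E → F}

theorem exists_norm_le_of_translation_invariant (hS : IsClosed S)
    (hSΓ : ∀ x ∈ S, ∀ g ∈ Γ, x + g ∈ S) (hB : Bornology.IsBounded B)
    (hSB : ∀ x ∈ S, ∃ g ∈ Γ, x + g ∈ B) (hf : ContinuousOn f S)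
    (hfΓ : ∀ x ∈ S, ∀ g ∈ Γ, f (x + g) = f x) : ∃ C, ∀ x ∈ S, ‖f x‖ ≤ C := by
  have hK : IsCompact (S ∩ closure B) := hB.isCompact_closure.inter_left hS
  obtain ⟨C, hC⟩ := hK.exists_bound_of_continuousOn (hf.mono inter_subset_left)
  refine ⟨C, fun x hx => ?_⟩
  obtain ⟨g, hg, hxg⟩ := hSB x hx
  rw [← hfΓ x hx g hg]
  exact hC _ ⟨hSΓ x hx g hg, subset_closure hxg⟩

theorem uniformContinuousOn_of_translation_invariant (hS : IsClosed S)
    (hSΓ : ∀ x ∈ S, ∀ g ∈ Γ, x + g ∈ S) (hB : Bornology.IsBounded B)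
    (hSB : ∀ x ∈ S, ∃ g ∈ Γ, x + g ∈ B) (hf : ContinuousOn f S)
    (hfΓ : ∀ x ∈ S, ∀ g ∈ Γ, f (x + g) = f x) : UniformContinuousOn f S := by
  have hK : IsCompact (S ∩ Metric.cthickening 1 B) :=
    (Metric.isCompact_of_isClosed_isBounded Metric.isClosed_cthickening
      hB.cthickening).inter_left hS
  have hfK := hK.uniformContinuousOn_of_continuous (hf.mono inter_subset_left)
  rw [Metric.uniformContinuousOn_iff] at hfK ⊢
  intro ε hε
  obtain ⟨d, hd, hfd⟩ := hfK ε hε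
  refine ⟨min d 1, lt_min hd one_pos, fun x hx y hy hxy => ?_⟩
  obtain ⟨g, hg, hxg⟩ := hSB x hx
  rw [← hfΓ x hx g hg, ← hfΓ y hy g hg]
  have hxy' : Dist.dist (x + g) (y + g) < min d 1 := by rwa [dist_add_right]
  refine hfd _ ⟨hSΓ x hx g hg, Metric.self_subset_cthickening B hxg⟩ _
    ⟨hSΓ y hy g hg, Metric.mem_cthickening_of_dist_le _ _ _ _ hxg ?_⟩
    (hxy'.trans_le (min_le_left _ _))
  rw [dist_comm]
  exact hxy'.le.trans (min_le_right _ _)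

end Translation

end Analysis

section Interaction

variable {ι : Type*} [Fintype ι] [DecidableEq ι]

theorem sum_sum_erase_comm (f : ι → ι → ℝ) :
    ∑ i, ∑ j ∈ Finset.univ.erase i, f i j = ∑ i, ∑ j ∈ Finset.univ.erase i, f j i :=
  Finset.sum_comm' fun i j => by simp [ne_comm]

theorem half_sum_sum_erase_add_swap (f : ι → ι → ℝ) :
    1 / 2 * ∑ i, ∑ j ∈ Finset.univ.erase i, (f i j + f j i)
      = ∑ i, ∑ j ∈ Finset.univ.erase i, f i j := by
  simp only [Finset.sum_add_distrib]
  rw [← sum_sum_erase_comm f]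
  ring

theorem sum_viscous_mul_sub_nonpos {q : ι → ι → ℝ} {g : ℝ → ℝ} (hg : Monotone g)
    (hq : ∀ i j, i ≠ j → 0 ≤ q i j) (hq_symm : ∀ i j, i ≠ j → q i j = q j i) (x : ι → ℝ) (c : ℝ) :
    ∑ i, (∑ j ∈ Finset.univ.erase i, q i j * (g (x j) - g (x i))) * (x i - c) ≤ 0 := by
  simp only [Finset.sum_mul]
  rw [← half_sum_sum_erase_add_swap]
  refine mul_nonpos_of_nonneg_of_nonpos (by norm_num)
    (Finset.sum_nonpos fun i _ => Finset.sum_nonpos fun j hj => ?_)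
  have hij : i ≠ j := (Finset.ne_of_mem_erase hj).symm
  have hmono : 0 ≤ (g (x i) - g (x j)) * (x i - x j) := by
    rcases le_total (x i) (x j) with hx | hx
    · exact mul_nonneg_of_nonpos_of_nonpos (sub_nonpos.2 (hg hx)) (sub_nonpos.2 hx)
    · exact mul_nonneg (sub_nonneg.2 (hg hx)) (sub_nonneg.2 hx)
  calc q i j * (g (x j) - g (x i)) * (x i - c) + q j i * (g (x i) - g (x j)) * (x j - c)
      = -(q i j * ((g (x i) - g (x j)) * (x i - x j))) := by rw [← hq_symm i j hij]; ring
    _ ≤ 0 := neg_nonpos.2 (mul_nonneg (hq i j hij) hmono)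

end Interaction

namespace Params

variable {n : ℕ}

/-- The standing assumptions on the parameters, for interactions of unbounded range and for
arbitrary weights of the inter-vehicle distance. -/
structure LongRangeAdmissible (P : Params n) : Prop where
  Rin_pos : 0 < P.Rin
  vmax_pos : 0 < P.vmax
  ω_pos : 0 < P.ω
  Θ_pos : 0 < P.Θ
  Θ_lt : P.Θ < Real.pi / 2
  cos_Θ : P.Rout * P.ω / P.vmax < Real.cos P.Θ
  σ_pos : ∀ i, 0 < P.σ i
  p_symm : ∀ i j, P.p i j = P.p j i
  L_pos : ∀ i j, i ≠ j → 0 < P.L i j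
  V_contDiff : ∀ i j, i ≠ j → ContDiffOn ℝ 2 (P.V i j) (Ioi (P.L i j))
  V_nonneg : ∀ i j, i ≠ j → ∀ d ∈ Ioi (P.L i j), 0 ≤ P.V i j d
  V_tendsto : ∀ i j, i ≠ j → Tendsto (P.V i j) (𝓝[>] (P.L i j)) atTop
  V_symm : ∀ i j, i ≠ j → ∀ d ∈ Ioi (P.L i j), P.V i j d = P.V j i d
  U_contDiff : ∀ i, ContDiffOn ℝ 2 (P.U i) (Ioo P.Rin P.Rout)
  U_nonneg : ∀ i, ∀ r ∈ Ioo P.Rin P.Rout, 0 ≤ P.U i r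
  U_tendsto_in : ∀ i, Tendsto (P.U i) (𝓝[>] P.Rin) atTop
  U_tendsto_out : ∀ i, Tendsto (P.U i) (𝓝[<] P.Rout) atTop
  κ_contDiff : ∀ i j, i ≠ j → ContDiffOn ℝ 1 (P.κ i j) (Ioi (P.L i j))
  κ_nonneg : ∀ i j, i ≠ j → ∀ d ∈ Ioi (P.L i j), 0 ≤ P.κ i j d
  κ_symm : ∀ i j, i ≠ j → ∀ d ∈ Ioi (P.L i j), P.κ i j d = P.κ j i d
  g₁_contDiff : ContDiff ℝ 1 P.g₁
  g₁_mono : Monotone P.g₁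
  g₂_contDiff : ContDiff ℝ 1 P.g₂
  g₂_mono : Monotone P.g₂
  f_contDiff : ContDiff ℝ 1 P.f
  le_f : ∀ x, max 0 x ≤ P.f x
  A_pos : 0 < P.A
  lt_b : 1 / P.Rin ^ 2 < P.b
  μ₁_pos : 0 < P.μ₁
  μ₂_pos : 0 < P.μ₂

theorem Admissible.longRangeAdmissible {P : Params n} (hP : P.Admissible) :
    P.LongRangeAdmissible :=
  { hP with }

/-- The states whose radii, orientations and mutual distances are admissible, without constraint
on the speeds. It is the natural domain of the feedback law and of `H`. -/
def dom (P : Params n) : Set (State n) :=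
  {w | (∀ i, w.r i ∈ Ioo P.Rin P.Rout) ∧ (∀ i, w.s i ∈ Ioo (-P.Θ) P.Θ) ∧
    ∀ i j, j ≠ i → P.L i j < P.dist w i j}

/-- The angular speed `φ̇ i` of the vehicle `i`. -/
noncomputable def angSpeed (w : State n) (i : Fin n) : ℝ :=
  w.v i / w.r i * Real.cos (w.s i)

/-- The radial component of the inter-vehicle forces, i.e. the sum which is subtracted in `Lam`. -/
noncomputable def radialForce (P : Params n) (w : State n) (i : Fin n) : ℝ :=
  ∑ j ∈ Finset.univ.erase i,
    (P.p i j * (w.r i - w.r j) + w.r j * (1 - Real.cos (w.φ i - w.φ j)))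
      * (deriv (P.V i j) (P.dist w i j) / P.dist w i j)

/-- The closed-loop value of `ṡ i`, obtained by inserting the steering angle `δ` into the bicycle
model; unlike `δ`, it does not involve the vehicle lengths. -/
noncomputable def sdot (P : Params n) (w : State n) (i : Fin n) : ℝ :=
  -(P.μ₂ * Real.sin (w.s i) + (P.b * P.F w i * Real.sin (w.s i) + P.Lam w i) * w.v i - P.M w i)
    / P.a (w.r i) (w.s i) (w.v i)

/-- The closed-loop vector field. -/
noncomputable def vectorField (P : Params n) (w : State n) : State n :=
  (fun i => -w.v i * Real.sin (w.s i), angSpeed w, P.sdot w, P.F w)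

variable {P : Params n}

theorem Ω_eq_dom_inter : P.Ω = P.dom ∩ {w | ∀ i, w.v i ∈ Ioo 0 P.vmax} := by
  ext w
  simp only [Ω, dom, mem_inter_iff, mem_ofPred_eq]
  tauto

theorem Ω_subset_dom : P.Ω ⊆ P.dom := fun _ hw => ⟨hw.1, hw.2.1, hw.2.2.2⟩

theorem continuous_dist (i j : Fin n) : Continuous fun w : State n => P.dist w i j := by
  unfold dist
  fun_prop

theorem isOpen_dom : IsOpen P.dom := by
  simp only [dom, ofPred_and, ofPred_forall]
  refine .inter (isOpen_iInter_of_finite fun i => ?_) (.inter (isOpen_iInter_of_finite fun i => ?_)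
    (isOpen_iInter_of_finite fun i => isOpen_iInter_of_finite fun j =>
      isOpen_iInter_of_finite fun _ => isOpen_lt continuous_const (continuous_dist i j)))
  · exact isOpen_Ioo.preimage (by fun_prop : Continuous fun w : State n => w.r i)
  · exact isOpen_Ioo.preimage (by fun_prop : Continuous fun w : State n => w.s i)

theorem isOpen_Ω : IsOpen P.Ω := by
  rw [Ω_eq_dom_inter]
  simp only [ofPred_forall]
  exact isOpen_dom.inter (isOpen_iInter_of_finite fun i =>
    isOpen_Ioo.preimage (by fun_prop : Continuous fun w : State n => w.v i))

namespace LongRangeAdmissible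

section Positivity

theorem cos_Θ_pos (hP : P.LongRangeAdmissible) : 0 < Real.cos P.Θ :=
  Real.cos_pos_of_mem_Ioo ⟨by linarith [hP.Θ_pos, Real.pi_pos], hP.Θ_lt⟩

theorem cos_Θ_lt_cos (hP : P.LongRangeAdmissible) {x : ℝ} (hx : x ∈ Ioo (-P.Θ) P.Θ) :
    Real.cos P.Θ < Real.cos x := by
  rw [← Real.cos_abs x]
  exact Real.cos_lt_cos_of_nonneg_of_le_pi (abs_nonneg x)
    (by linarith [hP.Θ_lt, Real.pi_pos]) (abs_lt.2 hx)

theorem Rout_mul_ω_lt_vmax_mul_cos_Θ (hP : P.LongRangeAdmissible) :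
    P.Rout * P.ω < P.vmax * Real.cos P.Θ := by
  rw [mul_comm P.vmax, ← div_lt_iff₀ hP.vmax_pos]
  exact hP.cos_Θ

variable {w : State n}

theorem r_pos (hP : P.LongRangeAdmissible) (hw : w ∈ P.dom) (i : Fin n) : 0 < w.r i :=
  hP.Rin_pos.trans (hw.1 i).1

theorem cos_pos (hP : P.LongRangeAdmissible) (hw : w ∈ P.dom) (i : Fin n) :
    0 < Real.cos (w.s i) :=
  hP.cos_Θ_pos.trans (hP.cos_Θ_lt_cos (hw.2.1 i))

theorem cos_sub_cos_Θ_pos (hP : P.LongRangeAdmissible) (hw : w ∈ P.dom) (i : Fin n) :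
    0 < Real.cos (w.s i) - Real.cos P.Θ :=
  sub_pos.2 (hP.cos_Θ_lt_cos (hw.2.1 i))

theorem r_mul_ω_lt_vmax_mul_cos (hP : P.LongRangeAdmissible) (hw : w ∈ P.dom) (i : Fin n) :
    w.r i * P.ω < P.vmax * Real.cos (w.s i) :=
  calc w.r i * P.ω < P.Rout * P.ω := mul_lt_mul_of_pos_right (hw.1 i).2 hP.ω_pos
    _ < P.vmax * Real.cos P.Θ := hP.Rout_mul_ω_lt_vmax_mul_cos_Θ
    _ < P.vmax * Real.cos (w.s i) :=
      mul_lt_mul_of_pos_left (hP.cos_Θ_lt_cos (hw.2.1 i)) hP.vmax_pos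

theorem dist_pos (hP : P.LongRangeAdmissible) (hw : w ∈ P.dom) {i j : Fin n} (hij : j ≠ i) :
    0 < P.dist w i j :=
  (hP.L_pos i j hij.symm).trans (hw.2.2 i j hij)

theorem b_pos (hP : P.LongRangeAdmissible) : 0 < P.b :=
  (one_div_pos.2 (pow_pos hP.Rin_pos 2)).trans hP.lt_b

theorem a_pos (hP : P.LongRangeAdmissible) (hw : w ∈ P.dom) (i : Fin n) (hv : 0 ≤ w.v i) :
    0 < P.a (w.r i) (w.s i) (w.v i) := by
  have hr := hP.r_pos hw i
  have hc := hP.cos_pos hw i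
  have hΘ := hP.cos_sub_cos_Θ_pos hw i
  have hb : 1 / w.r i ^ 2 < P.b :=
    (one_div_le_one_div_of_le (pow_pos hP.Rin_pos 2)
      (pow_le_pow_left₀ hP.Rin_pos.le (hw.1 i).1.le 2)).trans_lt hP.lt_b
  have := sub_pos.2 hb
  have := hP.A_pos
  have := hP.ω_pos
  unfold a
  positivity

theorem bicycle_eq_vectorField (hP : P.LongRangeAdmissible) (hw : w ∈ P.Ω) :
    P.bicycle w (P.F w) (P.δ w) = P.vectorField w := by
  refine Prod.ext rfl (Prod.ext rfl (Prod.ext (funext fun i => ?_) rfl))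
  have hv : 0 < w.v i := (hw.2.2.1 i).1
  have ha := hP.a_pos (Ω_subset_dom hw) i hv.le
  have hr := hP.r_pos (Ω_subset_dom hw) i
  have hσ := hP.σ_pos i
  simp only [bicycle, vectorField, δ, sdot, Real.tan_arctan]
  field_simp
  ring

theorem isSolutionOn_iff (hP : P.LongRangeAdmissible) {I : Set ℝ} {w : ℝ → State n} :
    P.IsSolutionOn I w ↔ IsIntegralCurveOn w (fun _ => P.vectorField) I ∧ MapsTo w I P.Ω := by
  rw [and_comm, MapsTo, IsIntegralCurveOn, ← forall₂_and]
  refine forall₂_congr fun t _ => and_congr_right fun hw => ?_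
  rw [hP.bicycle_eq_vectorField hw]

end Positivity

section Regularity

theorem contDiffOn_dist (hP : P.LongRangeAdmissible) {i j : Fin n} (hij : j ≠ i) :
    ContDiffOn ℝ 1 (fun w => P.dist w i j) P.dom := by
  unfold dist
  refine ContDiffOn.sqrt (by fun_prop) fun w hw => ?_
  exact (Real.sqrt_pos.1 (hP.dist_pos hw hij)).ne'

theorem contDiffOn_comp_dist (hP : P.LongRangeAdmissible) {i j : Fin n} (hij : j ≠ i)
    {h : ℝ → ℝ} (hh : ContDiffOn ℝ 1 h (Ioi (P.L i j))) :
    ContDiffOn ℝ 1 (fun w => h (P.dist w i j)) P.dom :=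
  hh.comp (hP.contDiffOn_dist hij) fun _ hw => hw.2.2 i j hij

theorem contDiffOn_deriv_V (hP : P.LongRangeAdmissible) {i j : Fin n} (hij : j ≠ i) :
    ContDiffOn ℝ 1 (fun w => deriv (P.V i j) (P.dist w i j)) P.dom :=
  hP.contDiffOn_comp_dist hij
    ((hP.V_contDiff i j hij.symm).deriv_of_isOpen isOpen_Ioi (by norm_num))

theorem contDiffOn_angSpeed (hP : P.LongRangeAdmissible) (i : Fin n) :
    ContDiffOn ℝ 1 (fun w => angSpeed w i) P.dom := by
  have hr : ∀ w ∈ P.dom, w.r i ≠ 0 := fun w hw => (hP.r_pos hw i).ne'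
  unfold angSpeed
  fun_prop (disch := assumption)

theorem contDiffOn_Phi (hP : P.LongRangeAdmissible) (i : Fin n) :
    ContDiffOn ℝ 1 (fun w => P.Phi w i) P.dom := by
  unfold Phi
  refine ContDiffOn.mul (by fun_prop) (ContDiffOn.sum fun j hj => ?_)
  have hij := Finset.ne_of_mem_erase hj
  have hV := hP.contDiffOn_deriv_V hij
  have hd := hP.contDiffOn_dist hij
  have hd₀ : ∀ w ∈ P.dom, P.dist w i j ≠ 0 := fun w hw => (hP.dist_pos hw hij).ne'
  fun_prop (disch := assumption)

theorem contDiffOn_G (hP : P.LongRangeAdmissible) (i : Fin n) :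
    ContDiffOn ℝ 1 (fun w => P.G w i) P.dom := by
  refine ContDiffOn.mul contDiffOn_const (ContDiffOn.sum fun j hj => ?_)
  have hij := Finset.ne_of_mem_erase hj
  exact (hP.contDiffOn_comp_dist hij (hP.κ_contDiff i j hij.symm)).mul
    ((hP.g₁_contDiff.comp_contDiffOn (hP.contDiffOn_angSpeed j)).sub
      (hP.g₁_contDiff.comp_contDiffOn (hP.contDiffOn_angSpeed i)))

theorem contDiffOn_M (hP : P.LongRangeAdmissible) (i : Fin n) :
    ContDiffOn ℝ 1 (fun w => P.M w i) P.dom := by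
  refine ContDiffOn.sum fun j hj => ?_
  have hij := Finset.ne_of_mem_erase hj
  have hg := hP.g₂_contDiff
  exact (hP.contDiffOn_comp_dist hij (hP.κ_contDiff i j hij.symm)).mul (by fun_prop)

theorem contDiffOn_radialForce (hP : P.LongRangeAdmissible) (i : Fin n) :
    ContDiffOn ℝ 1 (fun w => P.radialForce w i) P.dom := by
  refine ContDiffOn.sum fun j hj => ?_
  have hij := Finset.ne_of_mem_erase hj
  have hV := hP.contDiffOn_deriv_V hij
  have hd := hP.contDiffOn_dist hij
  have hd₀ : ∀ w ∈ P.dom, P.dist w i j ≠ 0 := fun w hw => (hP.dist_pos hw hij).ne'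
  fun_prop (disch := assumption)

theorem contDiffOn_Lam (hP : P.LongRangeAdmissible) (i : Fin n) :
    ContDiffOn ℝ 1 (fun w => P.Lam w i) P.dom := by
  have hr : ∀ w ∈ P.dom, w.r i ^ 2 ≠ 0 := fun w hw => (pow_pos (hP.r_pos hw i) 2).ne'
  have hU : ContDiffOn ℝ 1 (fun w : State n => deriv (P.U i) (w.r i)) P.dom :=
    ((hP.U_contDiff i).deriv_of_isOpen isOpen_Ioo (by norm_num)).comp (by fun_prop)
      fun w hw => hw.1 i
  exact ((((hP.contDiffOn_angSpeed i).sub contDiffOn_const).mul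
    (by fun_prop (disch := assumption))).sub hU).sub (hP.contDiffOn_radialForce i)

theorem contDiffOn_k (hP : P.LongRangeAdmissible) (i : Fin n) :
    ContDiffOn ℝ 1 (fun w => P.k w i) P.dom := by
  have hΦ := hP.contDiffOn_Phi i
  have hG := hP.contDiffOn_G i
  have hden : ∀ w ∈ P.dom, P.vmax * Real.cos (w.s i) - w.r i * P.ω ≠ 0 :=
    fun w hw => (sub_pos.2 (hP.r_mul_ω_lt_vmax_mul_cos hw i)).ne'
  have hf := hP.f_contDiff
  unfold k
  fun_prop (disch := assumption)

theorem contDiffOn_F (hP : P.LongRangeAdmissible) : ContDiffOn ℝ 1 P.F P.dom := by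
  refine contDiffOn_pi.2 fun i => ?_
  have hΦ := hP.contDiffOn_Phi i
  have hG := hP.contDiffOn_G i
  have hk := hP.contDiffOn_k i
  have hc : ∀ w ∈ P.dom, Real.cos (w.s i) ≠ 0 := fun w hw => (hP.cos_pos hw i).ne'
  unfold F
  fun_prop (disch := assumption)

theorem contDiffOn_a (hP : P.LongRangeAdmissible) (i : Fin n) :
    ContDiffOn ℝ 1 (fun w : State n => P.a (w.r i) (w.s i) (w.v i)) P.dom := by
  have hr : ∀ w ∈ P.dom, w.r i ≠ 0 := fun w hw => (hP.r_pos hw i).ne'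
  have hr2 : ∀ w ∈ P.dom, w.r i ^ 2 ≠ 0 := fun w hw => pow_ne_zero 2 (hr w hw)
  have hΘ : ∀ w ∈ P.dom, (Real.cos (w.s i) - Real.cos P.Θ) ^ 2 ≠ 0 :=
    fun w hw => pow_ne_zero 2 (hP.cos_sub_cos_Θ_pos hw i).ne'
  unfold a
  fun_prop (disch := assumption)

theorem contDiffOn_sdot (hP : P.LongRangeAdmissible) : ContDiffOn ℝ 1 P.sdot P.Ω := by
  refine contDiffOn_pi.2 fun i => ?_
  have hF : ContDiffOn ℝ 1 (fun w => P.F w i) P.Ω :=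
    (contDiffOn_pi.1 hP.contDiffOn_F i).mono Ω_subset_dom
  have hΛ := (hP.contDiffOn_Lam i).mono Ω_subset_dom
  have hM := (hP.contDiffOn_M i).mono Ω_subset_dom
  have ha := (hP.contDiffOn_a i).mono Ω_subset_dom
  have ha₀ : ∀ w ∈ P.Ω, P.a (w.r i) (w.s i) (w.v i) ≠ 0 :=
    fun w hw => (hP.a_pos (Ω_subset_dom hw) i (hw.2.2.1 i).1.le).ne'
  unfold sdot
  fun_prop (disch := assumption)

theorem contDiffOn_vectorField (hP : P.LongRangeAdmissible) :
    ContDiffOn ℝ 1 P.vectorField P.Ω :=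
  ContDiffOn.prodMk (by fun_prop) <|
    (contDiffOn_pi.2 fun i => (hP.contDiffOn_angSpeed i).mono Ω_subset_dom).prodMk <|
      hP.contDiffOn_sdot.prodMk (hP.contDiffOn_F.mono Ω_subset_dom)

end Regularity

end LongRangeAdmissible

section Turn

/-- The translation of the state space which moves the individual vehicles by full turns. All the
quantities of the model are invariant under it. -/
noncomputable def turn (m : Fin n → ℤ) : State n := (0, fun i => m i * (2 * Real.pi), 0, 0)

variable (w : State n) (m : Fin n → ℤ)

theorem r_add_turn : (w + turn m).r = w.r := add_zero _

theorem s_add_turn : (w + turn m).s = w.s := add_zero _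

theorem v_add_turn : (w + turn m).v = w.v := add_zero _

theorem φ_add_turn (i : Fin n) : (w + turn m).φ i = w.φ i + m i * (2 * Real.pi) := rfl

theorem φ_add_turn_sub (i j : Fin n) :
    (w + turn m).φ i - (w + turn m).φ j
      = w.φ i - w.φ j + ((m i - m j : ℤ) : ℝ) * (2 * Real.pi) := by
  rw [φ_add_turn, φ_add_turn]
  push_cast
  ring

theorem cos_φ_add_turn_sub (i j : Fin n) :
    Real.cos ((w + turn m).φ i - (w + turn m).φ j) = Real.cos (w.φ i - w.φ j) := by
  rw [φ_add_turn_sub, Real.cos_add_int_mul_two_pi]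

theorem sin_φ_add_turn_sub (i j : Fin n) :
    Real.sin ((w + turn m).φ i - (w + turn m).φ j) = Real.sin (w.φ i - w.φ j) := by
  rw [φ_add_turn_sub, Real.sin_add_int_mul_two_pi]

theorem angSpeed_add_turn : angSpeed (w + turn m) = angSpeed w := by
  ext i
  simp only [angSpeed, r_add_turn, s_add_turn, v_add_turn]

theorem dist_add_turn : P.dist (w + turn m) = P.dist w := by
  ext i j
  simp only [dist, r_add_turn, cos_φ_add_turn_sub]

theorem H_add_turn : P.H (w + turn m) = P.H w := by
  simp only [H, r_add_turn, s_add_turn, v_add_turn, dist_add_turn]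

theorem Phi_add_turn : P.Phi (w + turn m) = P.Phi w := by
  ext i
  simp only [Phi, r_add_turn, dist_add_turn, sin_φ_add_turn_sub]

theorem G_add_turn : P.G (w + turn m) = P.G w := by
  ext i
  simp only [G, r_add_turn, s_add_turn, v_add_turn, dist_add_turn]

theorem M_add_turn : P.M (w + turn m) = P.M w := by
  ext i
  simp only [M, s_add_turn, dist_add_turn]

theorem Lam_add_turn : P.Lam (w + turn m) = P.Lam w := by
  ext i
  simp only [Lam, r_add_turn, s_add_turn, v_add_turn, dist_add_turn, cos_φ_add_turn_sub]

theorem k_add_turn : P.k (w + turn m) = P.k w := by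
  ext i
  simp only [k, r_add_turn, s_add_turn, Phi_add_turn, G_add_turn]

theorem F_add_turn : P.F (w + turn m) = P.F w := by
  ext i
  simp only [F, r_add_turn, s_add_turn, v_add_turn, k_add_turn, Phi_add_turn, G_add_turn]

theorem sdot_add_turn : P.sdot (w + turn m) = P.sdot w := by
  ext i
  simp only [sdot, r_add_turn, s_add_turn, v_add_turn, F_add_turn, Lam_add_turn, M_add_turn]

theorem vectorField_add_turn : P.vectorField (w + turn m) = P.vectorField w := by
  simp only [vectorField, s_add_turn, v_add_turn, angSpeed_add_turn, F_add_turn, sdot_add_turn]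

end Turn

section Derivatives

/-- The angular acceleration `φ̈ i` along solutions. -/
noncomputable def angAcc (P : Params n) (w : State n) (i : Fin n) : ℝ :=
  P.F w i / w.r i * Real.cos (w.s i)
    + w.v i ^ 2 * Real.sin (w.s i) * Real.cos (w.s i) / w.r i ^ 2
    - w.v i / w.r i * Real.sin (w.s i) * P.sdot w i

/-- The derivative of `H` along solutions. -/
noncomputable def Hdot (P : Params n) (w : State n) : ℝ :=
  ∑ i, (-P.k w i * (angSpeed w i - P.ω) ^ 2 + P.ω * P.G w i * (angSpeed w i - P.ω)
    - P.μ₂ * Real.sin (w.s i) ^ 2 + P.M w i * Real.sin (w.s i))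

variable {w : ℝ → State n} {I : Set ℝ} {t : ℝ}

theorem hasDerivWithinAt_r (hw : HasDerivWithinAt w (P.vectorField (w t)) I t) (i : Fin n) :
    HasDerivWithinAt (fun τ => (w τ).r i) (-(w t).v i * Real.sin ((w t).s i)) I t :=
  hasDerivWithinAt_pi.1 (hasFDerivAt_fst.comp_hasDerivWithinAt t hw) i

theorem hasDerivWithinAt_φ (hw : HasDerivWithinAt w (P.vectorField (w t)) I t) (i : Fin n) :
    HasDerivWithinAt (fun τ => (w τ).φ i) (angSpeed (w t) i) I t :=
  hasDerivWithinAt_pi.1 (hasFDerivAt_fst.comp_hasDerivWithinAt t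
    (hasFDerivAt_snd.comp_hasDerivWithinAt t hw)) i

theorem hasDerivWithinAt_s (hw : HasDerivWithinAt w (P.vectorField (w t)) I t) (i : Fin n) :
    HasDerivWithinAt (fun τ => (w τ).s i) (P.sdot (w t) i) I t :=
  hasDerivWithinAt_pi.1 (hasFDerivAt_fst.comp_hasDerivWithinAt t
    (hasFDerivAt_snd.comp_hasDerivWithinAt t (hasFDerivAt_snd.comp_hasDerivWithinAt t hw))) i

theorem hasDerivWithinAt_v (hw : HasDerivWithinAt w (P.vectorField (w t)) I t) (i : Fin n) :
    HasDerivWithinAt (fun τ => (w τ).v i) (P.F (w t) i) I t :=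
  hasDerivWithinAt_pi.1 (hasFDerivAt_snd.comp_hasDerivWithinAt t
    (hasFDerivAt_snd.comp_hasDerivWithinAt t (hasFDerivAt_snd.comp_hasDerivWithinAt t hw))) i

namespace LongRangeAdmissible

theorem hasDerivWithinAt_angSpeed (hP : P.LongRangeAdmissible)
    (hw : HasDerivWithinAt w (P.vectorField (w t)) I t) (hwt : w t ∈ P.dom) (i : Fin n) :
    HasDerivWithinAt (fun τ => angSpeed (w τ) i) (P.angAcc (w t) i) I t := by
  have hr := (hP.r_pos hwt i).ne'
  refine (((hasDerivWithinAt_v hw i).div (hasDerivWithinAt_r hw i) hr).mul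
    (hasDerivWithinAt_s hw i).cos).congr_deriv ?_
  simp only [angAcc, Pi.div_apply]
  field_simp
  ring

theorem hasDerivWithinAt_dist (hP : P.LongRangeAdmissible)
    (hw : HasDerivWithinAt w (P.vectorField (w t)) I t) (hwt : w t ∈ P.dom) {i j : Fin n}
    (hij : j ≠ i) :
    HasDerivWithinAt (fun τ => P.dist (w τ) i j)
      (((P.p i j * ((w t).r i - (w t).r j)
            + (w t).r j * (1 - Real.cos ((w t).φ i - (w t).φ j)))
          * (-(w t).v i * Real.sin ((w t).s i))
        + (P.p i j * ((w t).r j - (w t).r i)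
            + (w t).r i * (1 - Real.cos ((w t).φ i - (w t).φ j)))
          * (-(w t).v j * Real.sin ((w t).s j))
        + (w t).r i * (w t).r j * Real.sin ((w t).φ i - (w t).φ j)
          * (angSpeed (w t) i - angSpeed (w t) j)) / P.dist (w t) i j) I t := by
  have hd := hP.dist_pos hwt hij
  have hri := hasDerivWithinAt_r hw i
  have hrj := hasDerivWithinAt_r hw j
  have hφ := ((hasDerivWithinAt_φ hw i).sub (hasDerivWithinAt_φ hw j)).cos.const_sub 1
  have h := ((((hri.sub hrj).pow 2).const_mul (P.p i j)).add
    (((hri.const_mul 2).mul hrj).mul hφ)).sqrt (Real.sqrt_pos.1 hd).ne'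
  refine h.congr_deriv ?_
  simp only [Pi.add_apply, Pi.sub_apply, Pi.mul_apply, Pi.pow_apply]
  rw [← dist]
  field_simp
  ring

theorem hasDerivWithinAt_U (hP : P.LongRangeAdmissible)
    (hw : HasDerivWithinAt w (P.vectorField (w t)) I t) (hwt : w t ∈ P.dom) (i : Fin n) :
    HasDerivWithinAt (fun τ => P.U i ((w τ).r i))
      (deriv (P.U i) ((w t).r i) * (-(w t).v i * Real.sin ((w t).s i))) I t :=
  (((hP.U_contDiff i).differentiableOn two_ne_zero).differentiableAt
    (isOpen_Ioo.mem_nhds (hwt.1 i))).hasDerivAt.comp_hasDerivWithinAt t (hasDerivWithinAt_r hw i)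

theorem hasDerivWithinAt_V (hP : P.LongRangeAdmissible) (hwt : w t ∈ P.dom) {i j : Fin n}
    (hij : j ≠ i) {d' : ℝ} (hd : HasDerivWithinAt (fun τ => P.dist (w τ) i j) d' I t) :
    HasDerivWithinAt (fun τ => P.V i j (P.dist (w τ) i j))
      (deriv (P.V i j) (P.dist (w t) i j) * d') I t :=
  HasDerivAt.comp_hasDerivWithinAt t
    (((hP.V_contDiff i j hij.symm).differentiableOn two_ne_zero).differentiableAt
      (isOpen_Ioi.mem_nhds (hwt.2.2 i j hij))).hasDerivAt hd

theorem dist_swap (hP : P.LongRangeAdmissible) (w : State n) (i j : Fin n) :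
    P.dist w i j = P.dist w j i := by
  unfold dist
  rw [hP.p_symm i j, ← Real.cos_neg (w.φ i - w.φ j), neg_sub]
  ring_nf

theorem deriv_V_swap (hP : P.LongRangeAdmissible) {w : State n} (hw : w ∈ P.dom) {i j : Fin n}
    (hij : j ≠ i) :
    deriv (P.V i j) (P.dist w i j) = deriv (P.V j i) (P.dist w j i) := by
  rw [hP.dist_swap w j i]
  refine Filter.EventuallyEq.deriv_eq ?_
  filter_upwards [Ioi_mem_nhds (hw.2.2 i j hij)] with d hd
  exact hP.V_symm i j hij.symm d hd

theorem ω_mul_Phi (hP : P.LongRangeAdmissible) (w : State n) (i : Fin n) :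
    P.ω * P.Phi w i = ∑ j ∈ Finset.univ.erase i, deriv (P.V i j) (P.dist w i j) / P.dist w i j
      * (w.r i * w.r j * Real.sin (w.φ i - w.φ j)) := by
  rw [Phi, ← mul_assoc, mul_div_cancel₀ _ hP.ω_pos.ne', Finset.mul_sum]
  exact Finset.sum_congr rfl fun j _ => by ring

theorem sum_ω_mul_Phi_eq_zero (hP : P.LongRangeAdmissible) {w : State n} (hw : w ∈ P.dom) :
    ∑ i, P.ω * P.Phi w i = 0 := by
  simp only [hP.ω_mul_Phi]
  rw [← half_sum_sum_erase_add_swap]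
  refine mul_eq_zero_of_right _ (Finset.sum_eq_zero fun i _ => Finset.sum_eq_zero fun j hj => ?_)
  rw [← hP.deriv_V_swap hw (Finset.ne_of_mem_erase hj), hP.dist_swap w j i,
    ← neg_sub (w.φ i), Real.sin_neg]
  ring

/- The interaction potentials see angular speeds through their differences only, so `angSpeed` may
be replaced by its deviation from `ω`. -/
theorem sum_ω_mul_Phi_mul_angSpeed_sub (hP : P.LongRangeAdmissible) {w : State n}
    (hw : w ∈ P.dom) :
    ∑ i, P.ω * P.Phi w i * (angSpeed w i - P.ω) = ∑ i, P.ω * P.Phi w i * angSpeed w i := by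
  simp only [mul_sub, Finset.sum_sub_distrib, ← Finset.sum_mul, hP.sum_ω_mul_Phi_eq_zero hw]
  ring

theorem hasDerivWithinAt_interaction (hP : P.LongRangeAdmissible)
    (hw : HasDerivWithinAt w (P.vectorField (w t)) I t) (hwt : w t ∈ P.dom) :
    HasDerivWithinAt
      (fun τ => 1 / 2 * ∑ i, ∑ j ∈ Finset.univ.erase i, P.V i j (P.dist (w τ) i j))
      (∑ i, (P.radialForce (w t) i * (-(w t).v i * Real.sin ((w t).s i))
        + P.ω * P.Phi (w t) i * (angSpeed (w t) i - P.ω))) I t := by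
  have hV : ∀ i, ∀ j ∈ Finset.univ.erase i, HasDerivWithinAt
      (fun τ => P.V i j (P.dist (w τ) i j)) _ I t := fun i j hj =>
    have hij := Finset.ne_of_mem_erase hj
    hP.hasDerivWithinAt_V hwt hij (hP.hasDerivWithinAt_dist hw hwt hij)
  refine ((HasDerivWithinAt.fun_sum fun i _ => HasDerivWithinAt.fun_sum (hV i)).const_mul
    (1 / 2)).congr_deriv ?_
  rw [Finset.sum_add_distrib, hP.sum_ω_mul_Phi_mul_angSpeed_sub hwt, ← Finset.sum_add_distrib]
  simp only [hP.ω_mul_Phi, radialForce, Finset.sum_mul, ← Finset.sum_add_distrib]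
  refine Eq.trans ?_ (half_sum_sum_erase_add_swap _)
  congr 1
  refine Finset.sum_congr rfl fun i _ => Finset.sum_congr rfl fun j hj => ?_
  rw [← hP.deriv_V_swap hwt (Finset.ne_of_mem_erase hj), hP.dist_swap (w t) j i,
    ← neg_sub ((w t).φ i), Real.sin_neg, Real.cos_neg, hP.p_symm j i]
  ring

theorem F_div_r_mul_cos (hP : P.LongRangeAdmissible) {w : State n} (hw : w ∈ P.dom) (i : Fin n) :
    P.F w i / w.r i * Real.cos (w.s i)
      = -P.k w i * (angSpeed w i - P.ω) - P.ω * (P.Phi w i - P.G w i) := by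
  have hr := hP.r_pos hw i
  have hc := hP.cos_pos hw i
  simp only [F, angSpeed]
  field_simp

theorem sdot_mul_a (hP : P.LongRangeAdmissible) {w : State n} (hw : w ∈ P.Ω) (i : Fin n) :
    P.sdot w i * P.a (w.r i) (w.s i) (w.v i)
      = -(P.μ₂ * Real.sin (w.s i)
        + (P.b * P.F w i * Real.sin (w.s i) + P.Lam w i) * w.v i - P.M w i) := by
  rw [sdot, div_mul_cancel₀ _ (hP.a_pos (Ω_subset_dom hw) i (hw.2.2.1 i).1.le).ne']

theorem dissipation_identity (hP : P.LongRangeAdmissible) {w : State n} (hw : w ∈ P.Ω)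
    (i : Fin n) :
    (angSpeed w i - P.ω) * P.angAcc w i
      + P.b * (w.v i * P.F w i * Real.sin (w.s i) ^ 2
        + w.v i ^ 2 * Real.sin (w.s i) * Real.cos (w.s i) * P.sdot w i)
      + deriv (P.U i) (w.r i) * (-w.v i * Real.sin (w.s i))
      + (P.radialForce w i * (-w.v i * Real.sin (w.s i))
        + P.ω * P.Phi w i * (angSpeed w i - P.ω))
      + P.A * (Real.sin (w.s i) * P.sdot w i / (Real.cos (w.s i) - Real.cos P.Θ) ^ 2)
    = -P.k w i * (angSpeed w i - P.ω) ^ 2 + P.ω * P.G w i * (angSpeed w i - P.ω)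
      - P.μ₂ * Real.sin (w.s i) ^ 2 + P.M w i * Real.sin (w.s i) := by
  have hF := hP.F_div_r_mul_cos (Ω_subset_dom hw) i
  have hs := hP.sdot_mul_a hw i
  simp only [a, Lam] at hs
  simp only [angAcc, radialForce]
  simp only [angSpeed] at hF ⊢
  linear_combination (w.v i / w.r i * Real.cos (w.s i) - P.ω) * hF + Real.sin (w.s i) * hs

theorem hasDerivWithinAt_H (hP : P.LongRangeAdmissible)
    (hw : HasDerivWithinAt w (P.vectorField (w t)) I t) (hwt : w t ∈ P.Ω) :
    HasDerivWithinAt (fun τ => P.H (w τ)) (P.Hdot (w t)) I t := by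
  have hd := Ω_subset_dom hwt
  have hangular : ∀ i ∈ Finset.univ, HasDerivWithinAt _ _ I t := fun i _ =>
    ((hP.hasDerivWithinAt_angSpeed hw hd i).sub_const P.ω).fun_pow 2
  have hlateral : ∀ i ∈ Finset.univ, HasDerivWithinAt _ _ I t := fun i _ =>
    ((hasDerivWithinAt_v hw i).fun_pow 2).fun_mul ((hasDerivWithinAt_s hw i).sin.fun_pow 2)
  have hboundary : ∀ i ∈ Finset.univ, HasDerivWithinAt _ _ I t := fun i _ =>
    hP.hasDerivWithinAt_U hw hd i
  have hbarrier : ∀ i ∈ Finset.univ, HasDerivWithinAt _ _ I t := fun i _ =>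
    (((hasDerivWithinAt_s hw i).cos.sub_const (Real.cos P.Θ)).fun_inv
      (hP.cos_sub_cos_Θ_pos hd i).ne').sub_const (1 / (1 - Real.cos P.Θ))
  have h := (((((HasDerivWithinAt.fun_sum hangular).const_mul (1 / 2)).fun_add
    ((HasDerivWithinAt.fun_sum hlateral).const_mul (P.b / 2))).fun_add
    (HasDerivWithinAt.fun_sum hboundary)).fun_add (hP.hasDerivWithinAt_interaction hw hd)).fun_add
    ((HasDerivWithinAt.fun_sum hbarrier).const_mul P.A)
  refine (h.congr_deriv ?_).congr (fun τ _ => ?_) ?_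
  · simp only [Hdot, Finset.mul_sum]
    rw [← Finset.sum_add_distrib, ← Finset.sum_add_distrib, ← Finset.sum_add_distrib,
      ← Finset.sum_add_distrib]
    refine Finset.sum_congr rfl fun i _ => ?_
    rw [← hP.dissipation_identity hwt i]
    ring
  · simp only [H, angSpeed, one_div]
  · simp only [H, angSpeed, one_div]

end LongRangeAdmissible

end Derivatives

namespace LongRangeAdmissible

section Dissipation

variable {w : State n}

theorem μ₁_le_k (hP : P.LongRangeAdmissible) (hw : w ∈ P.dom) (i : Fin n) : P.μ₁ ≤ P.k w i := by
  have hden := sub_pos.2 (hP.r_mul_ω_lt_vmax_mul_cos hw i)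
  have hone : 1 ≤ P.vmax * Real.cos (w.s i) / (P.vmax * Real.cos (w.s i) - w.r i * P.ω) := by
    rw [one_le_div hden]
    linarith [mul_pos (hP.r_pos hw i) hP.ω_pos]
  have hf := hP.le_f (-(P.vmax * Real.cos (w.s i)
      / (P.vmax * Real.cos (w.s i) - w.r i * P.ω)) * (P.Phi w i - P.G w i))
  have hf_nonneg := (le_max_left _ _).trans hf
  have hf_ge := (le_max_right _ _).trans hf
  unfold k
  rcases le_total 0 (P.Phi w i - P.G w i) with hZ | hZ
  · linarith
  · nlinarith

theorem κ_dist_nonneg (hP : P.LongRangeAdmissible) (hw : w ∈ P.dom) (i j : Fin n) (hij : i ≠ j) :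
    0 ≤ P.κ i j (P.dist w i j) :=
  hP.κ_nonneg i j hij _ (hw.2.2 i j hij.symm)

theorem κ_dist_swap (hP : P.LongRangeAdmissible) (hw : w ∈ P.dom) (i j : Fin n) (hij : i ≠ j) :
    P.κ i j (P.dist w i j) = P.κ j i (P.dist w j i) := by
  rw [hP.dist_swap w j i]
  exact hP.κ_symm i j hij _ (hw.2.2 i j hij.symm)

theorem sum_ω_mul_G_mul_nonpos (hP : P.LongRangeAdmissible) (hw : w ∈ P.dom) :
    ∑ i, P.ω * P.G w i * (angSpeed w i - P.ω) ≤ 0 := by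
  simp only [G, ← mul_assoc, mul_one_div_cancel hP.ω_pos.ne', one_mul]
  exact sum_viscous_mul_sub_nonpos hP.g₁_mono (hP.κ_dist_nonneg hw) (hP.κ_dist_swap hw)
    (angSpeed w) P.ω

theorem sum_M_mul_sin_nonpos (hP : P.LongRangeAdmissible) (hw : w ∈ P.dom) :
    ∑ i, P.M w i * Real.sin (w.s i) ≤ 0 := by
  unfold M
  simpa only [sub_zero] using sum_viscous_mul_sub_nonpos hP.g₂_mono (hP.κ_dist_nonneg hw)
    (hP.κ_dist_swap hw) (fun i => Real.sin (w.s i)) 0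

theorem Hdot_le (hP : P.LongRangeAdmissible) (hw : w ∈ P.dom) :
    P.Hdot w ≤ -∑ i, (P.μ₁ * (angSpeed w i - P.ω) ^ 2 + P.μ₂ * Real.sin (w.s i) ^ 2) := by
  have hG := hP.sum_ω_mul_G_mul_nonpos hw
  have hM := hP.sum_M_mul_sin_nonpos hw
  have hk : ∑ i, -P.k w i * (angSpeed w i - P.ω) ^ 2 ≤ ∑ i, -P.μ₁ * (angSpeed w i - P.ω) ^ 2 :=
    Finset.sum_le_sum fun i _ =>
      mul_le_mul_of_nonneg_right (neg_le_neg (hP.μ₁_le_k hw i)) (sq_nonneg _)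
  simp only [Hdot, Finset.sum_add_distrib, Finset.sum_sub_distrib, neg_mul,
    Finset.sum_neg_distrib] at hk ⊢
  linarith

theorem antitoneOn_H (hP : P.LongRangeAdmissible) {w : ℝ → State n} {I : Set ℝ} (hI : Convex ℝ I)
    (hw : IsIntegralCurveOn w (fun _ => P.vectorField) I) (hwΩ : MapsTo w I P.Ω) :
    AntitoneOn (fun t => P.H (w t)) I := by
  have hH := fun t ht => hP.hasDerivWithinAt_H (hw t ht) (hwΩ ht)
  refine antitoneOn_of_hasDerivWithinAt_nonpos hI (fun t ht => (hH t ht).continuousWithinAt)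
    (fun t ht => (hH t (interior_subset ht)).mono interior_subset) fun t ht => ?_
  refine (hP.Hdot_le (Ω_subset_dom (hwΩ (interior_subset ht)))).trans
    (neg_nonpos.2 (Finset.sum_nonneg fun i _ => ?_))
  have := hP.μ₁_pos
  have := hP.μ₂_pos
  positivity

end Dissipation

end LongRangeAdmissible

section Coercivity

/-- The orientation barrier of `H`. -/
noncomputable def barrier (P : Params n) (x : ℝ) : ℝ :=
  P.A * (1 / (Real.cos x - Real.cos P.Θ) - 1 / (1 - Real.cos P.Θ))

namespace LongRangeAdmissible

variable {w : State n}

theorem barrier_nonneg (hP : P.LongRangeAdmissible) (hw : w ∈ P.dom) (i : Fin n) :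
    0 ≤ P.barrier (w.s i) :=
  mul_nonneg hP.A_pos.le (sub_nonneg.2 (one_div_le_one_div_of_le (hP.cos_sub_cos_Θ_pos hw i)
    (sub_le_sub_right (Real.cos_le_one _) _)))

theorem V_dist_nonneg (hP : P.LongRangeAdmissible) (hw : w ∈ P.dom) (i : Fin n) :
    ∀ j ∈ Finset.univ.erase i, 0 ≤ P.V i j (P.dist w i j) := fun j hj =>
  hP.V_nonneg i j (Finset.ne_of_mem_erase hj).symm _ (hw.2.2 i j (Finset.ne_of_mem_erase hj))

theorem sum_U_nonneg (hP : P.LongRangeAdmissible) (hw : w ∈ P.dom) : 0 ≤ ∑ i, P.U i (w.r i) :=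
  Finset.sum_nonneg fun i _ => hP.U_nonneg i _ (hw.1 i)

theorem sum_V_nonneg (hP : P.LongRangeAdmissible) (hw : w ∈ P.dom) :
    0 ≤ ∑ i, ∑ j ∈ Finset.univ.erase i, P.V i j (P.dist w i j) :=
  Finset.sum_nonneg fun i _ => Finset.sum_nonneg (hP.V_dist_nonneg hw i)

theorem sum_barrier_nonneg (hP : P.LongRangeAdmissible) (hw : w ∈ P.dom) :
    0 ≤ ∑ i, P.barrier (w.s i) :=
  Finset.sum_nonneg fun i _ => hP.barrier_nonneg hw i

theorem sum_potentials_le_H (hP : P.LongRangeAdmissible) (w : State n) :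
    (∑ i, P.U i (w.r i)) + 1 / 2 * ∑ i, ∑ j ∈ Finset.univ.erase i, P.V i j (P.dist w i j)
      + ∑ i, P.barrier (w.s i) ≤ P.H w := by
  have hangular : 0 ≤ ∑ i, (w.v i / w.r i * Real.cos (w.s i) - P.ω) ^ 2 :=
    Finset.sum_nonneg fun i _ => sq_nonneg _
  have hlateral : 0 ≤ P.b / 2 * ∑ i, w.v i ^ 2 * Real.sin (w.s i) ^ 2 :=
    mul_nonneg (half_pos hP.b_pos).le (Finset.sum_nonneg fun i _ => by positivity)
  simp only [barrier, ← Finset.mul_sum]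
  unfold H
  linarith

theorem H_nonneg (hP : P.LongRangeAdmissible) (hw : w ∈ P.dom) : 0 ≤ P.H w := by
  linarith [hP.sum_potentials_le_H w, hP.sum_U_nonneg hw, hP.sum_V_nonneg hw,
    hP.sum_barrier_nonneg hw]

theorem U_le_H (hP : P.LongRangeAdmissible) (hw : w ∈ P.dom) (i : Fin n) :
    P.U i (w.r i) ≤ P.H w := by
  have := Finset.single_le_sum (fun i _ => hP.U_nonneg i _ (hw.1 i)) (Finset.mem_univ i)
  linarith [hP.sum_potentials_le_H w, hP.sum_V_nonneg hw, hP.sum_barrier_nonneg hw]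

theorem half_V_le_H (hP : P.LongRangeAdmissible) (hw : w ∈ P.dom) {i j : Fin n} (hij : j ≠ i) :
    P.V i j (P.dist w i j) / 2 ≤ P.H w := by
  have hj := Finset.single_le_sum (hP.V_dist_nonneg hw i)
    (Finset.mem_erase.2 ⟨hij, Finset.mem_univ j⟩)
  have hi := Finset.single_le_sum (f := fun i => ∑ j ∈ Finset.univ.erase i, P.V i j (P.dist w i j))
    (fun i _ => Finset.sum_nonneg (hP.V_dist_nonneg hw i)) (Finset.mem_univ i)
  linarith [hP.sum_potentials_le_H w, hP.sum_U_nonneg hw, hP.sum_barrier_nonneg hw]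

theorem barrier_le_H (hP : P.LongRangeAdmissible) (hw : w ∈ P.dom) (i : Fin n) :
    P.barrier (w.s i) ≤ P.H w := by
  have := Finset.single_le_sum (fun i _ => hP.barrier_nonneg hw i) (Finset.mem_univ i)
  linarith [hP.sum_potentials_le_H w, hP.sum_U_nonneg hw, hP.sum_V_nonneg hw]

theorem tendsto_barrier (hP : P.LongRangeAdmissible) :
    Tendsto P.barrier (𝓝[<] P.Θ) atTop := by
  have hcont : Continuous fun x => Real.cos x - Real.cos P.Θ := by fun_prop
  have hcos : Tendsto (fun x => Real.cos x - Real.cos P.Θ) (𝓝[<] P.Θ) (𝓝[>] 0) := by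
    refine tendsto_nhdsWithin_iff.2
      ⟨(hcont.tendsto' _ _ (sub_self _)).mono_left nhdsWithin_le_nhds, ?_⟩
    filter_upwards [Ioo_mem_nhdsLT (neg_lt_self hP.Θ_pos)] with x hx
    exact sub_pos.2 (hP.cos_Θ_lt_cos hx)
  unfold barrier
  simp only [one_div, sub_eq_add_neg _ (1 - Real.cos P.Θ)⁻¹]
  exact (tendsto_atTop_add_const_right _ _ (tendsto_inv_nhdsGT_zero.comp hcos)).const_mul_atTop
    hP.A_pos

theorem continuousOn_H (hP : P.LongRangeAdmissible) : ContinuousOn P.H P.dom := by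
  have hω := fun i => (hP.contDiffOn_angSpeed i).continuousOn
  have hU : ∀ i, ContinuousOn (fun w : State n => P.U i (w.r i)) P.dom := fun i =>
    (hP.U_contDiff i).continuousOn.comp (by fun_prop) fun w hw => hw.1 i
  have hV : ∀ i, ∀ j ∈ Finset.univ.erase i,
      ContinuousOn (fun w => P.V i j (P.dist w i j)) P.dom := fun i j hj =>
    have hij := Finset.ne_of_mem_erase hj
    (hP.contDiffOn_comp_dist hij ((hP.V_contDiff i j hij.symm).of_le one_le_two)).continuousOn
  have hΘ : ∀ i, ∀ w ∈ P.dom, Real.cos (w.s i) - Real.cos P.Θ ≠ 0 := fun i w hw =>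
    (hP.cos_sub_cos_Θ_pos hw i).ne'
  unfold H
  unfold angSpeed at hω
  refine .add (.add (.add (.add ?_ (by fun_prop)) ?_) ?_) ?_
  · exact .const_mul (continuousOn_finsetSum _ fun i _ => ((hω i).sub continuousOn_const).pow 2) _
  · exact continuousOn_finsetSum _ fun i _ => hU i
  · exact .const_mul (continuousOn_finsetSum _ fun i _ => continuousOn_finsetSum _ (hV i)) _
  · exact .const_mul (continuousOn_finsetSum _ fun i _ =>
      (continuousOn_const.div (by fun_prop) (hΘ i)).sub continuousOn_const) _

end LongRangeAdmissible

end Coercivity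

section Core

/-- The states whose energy is at most `h` and whose speeds have distance at least `ε` to the ends
of `[0, vmax]`. Trajectories are confined to such sets, which are closed, and compact up to
translations by full turns. -/
def core (P : Params n) (h ε : ℝ) : Set (State n) :=
  {w ∈ P.dom | P.H w ≤ h} ∩ {w | ∀ i, w.v i ∈ Icc ε (P.vmax - ε)}

variable {h ε : ℝ} {w : State n}

theorem core_subset_dom : P.core h ε ⊆ P.dom := fun _ hw => hw.1.1

theorem core_subset_Ω (hε : 0 < ε) : P.core h ε ⊆ P.Ω := fun _ hw =>
  ⟨hw.1.1.1, hw.1.1.2.1, fun i => ⟨hε.trans_le (hw.2 i).1, (hw.2 i).2.trans_lt (sub_lt_self _ hε)⟩,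
    hw.1.1.2.2⟩

theorem mem_core_zero (hw : w ∈ P.Ω) (hwh : P.H w ≤ h) : w ∈ P.core h 0 :=
  ⟨⟨Ω_subset_dom hw, hwh⟩, fun i => ⟨(hw.2.2.1 i).1.le, by simpa using (hw.2.2.1 i).2.le⟩⟩

theorem add_turn_mem_core (hw : w ∈ P.core h ε) (m : Fin n → ℤ) : w + turn m ∈ P.core h ε := by
  simpa only [core, dom, mem_inter_iff, mem_ofPred_eq, r_add_turn, s_add_turn, v_add_turn,
    dist_add_turn, H_add_turn] using hw

theorem exists_add_turn_mem_Icc (hε : 0 ≤ ε) (hw : w ∈ P.core h ε) :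
    ∃ m, w + turn m ∈ Icc ((fun _ => P.Rin, fun _ => 0, fun _ => -P.Θ, fun _ => 0) : State n)
      (fun _ => P.Rout, fun _ => 2 * Real.pi, fun _ => P.Θ, fun _ => P.vmax) := by
  choose m hm _ using fun i => existsUnique_add_zsmul_mem_Ico Real.two_pi_pos (w.φ i) 0
  have hr : ∀ i, (w + turn m).r i ∈ Ioo P.Rin P.Rout := by simpa only [r_add_turn] using hw.1.1.1
  have hφ : ∀ i, (w + turn m).φ i ∈ Ico 0 (2 * Real.pi) := by
    simpa only [φ_add_turn, zsmul_eq_mul, zero_add] using hm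
  have hs : ∀ i, (w + turn m).s i ∈ Ioo (-P.Θ) P.Θ := by simpa only [s_add_turn] using hw.1.1.2.1
  have hv : ∀ i, (w + turn m).v i ∈ Icc 0 P.vmax := by
    simpa only [v_add_turn] using fun i => Icc_subset_Icc hε (sub_le_self _ hε) (hw.2 i)
  exact ⟨m,
    ⟨fun i => (hr i).1.le, fun i => (hφ i).1, fun i => (hs i).1.le, fun i => (hv i).1⟩,
    ⟨fun i => (hr i).2.le, fun i => (hφ i).2.le, fun i => (hs i).2.le, fun i => (hv i).2⟩⟩

namespace LongRangeAdmissible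

theorem tendsto_H_atTop (hP : P.LongRangeAdmissible) (hw : w ∉ P.dom) :
    Tendsto P.H (𝓝[P.dom] w) atTop := by
  simp only [dom, mem_ofPred_eq, not_and_or, not_forall, mem_Ioo, not_lt, ← abs_lt] at hw
  rcases hw with ⟨i, hr | hr⟩ | ⟨i, hs⟩ | ⟨i, j, hij, hd⟩
  · exact tendsto_nhdsWithin_atTop_of_comp_le (by fun_prop : Continuous fun w : State n => w.r i)
      (fun w hw => (hw.1 i).1) (tendsto_nhdsWithin_Ioi_of_le (hP.U_tendsto_in i) hr)
      fun w hw => hP.U_le_H hw i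
  · exact tendsto_nhdsWithin_atTop_of_comp_le (by fun_prop : Continuous fun w : State n => w.r i)
      (fun w hw => (hw.1 i).2) (tendsto_nhdsWithin_Iio_of_ge (hP.U_tendsto_out i) hr)
      fun w hw => hP.U_le_H hw i
  · refine tendsto_nhdsWithin_atTop_of_comp_le (t := Iio P.Θ)
      (by fun_prop : Continuous fun w : State n => |w.s i|) (fun w hw => abs_lt.2 (hw.2.1 i))
      (tendsto_nhdsWithin_Iio_of_ge hP.tendsto_barrier hs) fun w hw => ?_
    simpa only [barrier, Real.cos_abs] using hP.barrier_le_H hw i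
  · exact tendsto_nhdsWithin_atTop_of_comp_le (continuous_dist i j) (fun w hw => hw.2.2 i j hij)
      ((tendsto_nhdsWithin_Ioi_of_le (hP.V_tendsto i j hij.symm) hd).atTop_div_const two_pos)
      fun w hw => hP.half_V_le_H hw hij

theorem isClosed_core (hP : P.LongRangeAdmissible) : IsClosed (P.core h ε) := by
  refine (isClosed_sublevel_of_tendsto_atTop hP.continuousOn_H
    (fun _ => hP.tendsto_H_atTop) h).inter ?_
  simp only [ofPred_forall]
  exact isClosed_iInter fun i =>
    isClosed_Icc.preimage (by fun_prop : Continuous fun w : State n => w.v i)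

variable {E : Type*} [SeminormedAddCommGroup E] {f : State n → E}

theorem exists_norm_le_on_core (hP : P.LongRangeAdmissible) (hε : 0 ≤ ε)
    (hf : ContinuousOn f (P.core h ε)) (hturn : ∀ w m, f (w + turn m) = f w) :
    ∃ C, ∀ w ∈ P.core h ε, ‖f w‖ ≤ C :=
  exists_norm_le_of_translation_invariant (Γ := range turn) hP.isClosed_core
    (fun _ hw => forall_mem_range.2 (add_turn_mem_core hw)) (Metric.isBounded_Icc _ _)
    (fun _ hw => exists_range_iff.2 (exists_add_turn_mem_Icc hε hw)) hf
    fun w _ => forall_mem_range.2 (hturn w)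

theorem uniformContinuousOn_core (hP : P.LongRangeAdmissible) (hε : 0 ≤ ε)
    (hf : ContinuousOn f (P.core h ε)) (hturn : ∀ w m, f (w + turn m) = f w) :
    UniformContinuousOn f (P.core h ε) :=
  uniformContinuousOn_of_translation_invariant (Γ := range turn) hP.isClosed_core
    (fun _ hw => forall_mem_range.2 (add_turn_mem_core hw)) (Metric.isBounded_Icc _ _)
    (fun _ hw => exists_range_iff.2 (exists_add_turn_mem_Icc hε hw)) hf
    fun w _ => forall_mem_range.2 (hturn w)

end LongRangeAdmissible

end Core

section Invariance

/-- The speed at which the vehicle `i` would move along the road with the angular speed `ω`. -/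
noncomputable def cruiseSpeed (P : Params n) (w : State n) (i : Fin n) : ℝ :=
  w.r i * P.ω / Real.cos (w.s i)

namespace LongRangeAdmissible

variable {w : State n}

theorem Rin_mul_ω_le_cruiseSpeed (hP : P.LongRangeAdmissible) (hw : w ∈ P.dom) (i : Fin n) :
    P.Rin * P.ω ≤ P.cruiseSpeed w i :=
  calc P.Rin * P.ω ≤ w.r i * P.ω := mul_le_mul_of_nonneg_right (hw.1 i).1.le hP.ω_pos.le
    _ ≤ P.cruiseSpeed w i := le_div_self (mul_pos (hP.r_pos hw i) hP.ω_pos).le (hP.cos_pos hw i)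
      (Real.cos_le_one _)

theorem cruiseSpeed_le_div_cos_Θ (hP : P.LongRangeAdmissible) (hw : w ∈ P.dom) (i : Fin n) :
    P.cruiseSpeed w i ≤ P.Rout * P.ω / Real.cos P.Θ :=
  div_le_div₀ (mul_pos ((hP.r_pos hw i).trans (hw.1 i).2) hP.ω_pos).le
    (mul_le_mul_of_nonneg_right (hw.1 i).2.le hP.ω_pos.le) hP.cos_Θ_pos
    (hP.cos_Θ_lt_cos (hw.2.1 i)).le

theorem Rout_mul_ω_div_cos_Θ_lt_vmax (hP : P.LongRangeAdmissible) :
    P.Rout * P.ω / Real.cos P.Θ < P.vmax :=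
  (div_lt_iff₀ hP.cos_Θ_pos).2 hP.Rout_mul_ω_lt_vmax_mul_cos_Θ

theorem μ₁_le_k_sub_Phi_sub_G (hP : P.LongRangeAdmissible) (w : State n) (i : Fin n) :
    P.μ₁ ≤ P.k w i - (P.Phi w i - P.G w i) := by
  have := (le_max_left _ _).trans (hP.le_f (-(P.vmax * Real.cos (w.s i)
    / (P.vmax * Real.cos (w.s i) - w.r i * P.ω)) * (P.Phi w i - P.G w i)))
  unfold k
  linarith

theorem μ₁_mul_vmax_sub_cruiseSpeed_le (hP : P.LongRangeAdmissible) (hw : w ∈ P.dom) (i : Fin n) :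
    P.μ₁ * (P.vmax - P.cruiseSpeed w i) ≤ P.k w i * (P.vmax - P.cruiseSpeed w i)
      + P.cruiseSpeed w i * (P.Phi w i - P.G w i) := by
  have hc := hP.cos_pos hw i
  have hgap : 0 < P.vmax - P.cruiseSpeed w i :=
    sub_pos.2 ((hP.cruiseSpeed_le_div_cos_Θ hw i).trans_lt hP.Rout_mul_ω_div_cos_Θ_lt_vmax)
  have hratio : P.vmax * Real.cos (w.s i) / (P.vmax * Real.cos (w.s i) - w.r i * P.ω)
      * (P.vmax - P.cruiseSpeed w i) = P.vmax := by
    have := sub_pos.2 (hP.r_mul_ω_lt_vmax_mul_cos hw i)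
    unfold cruiseSpeed
    field_simp
  have hf := mul_le_mul_of_nonneg_right ((le_max_right _ _).trans (hP.le_f (-(P.vmax
    * Real.cos (w.s i) / (P.vmax * Real.cos (w.s i) - w.r i * P.ω)) * (P.Phi w i - P.G w i))))
    hgap.le
  unfold k
  linear_combination hf + (P.Phi w i - P.G w i) * hratio

theorem le_F (hP : P.LongRangeAdmissible) (hw : w ∈ P.dom) (i : Fin n) :
    P.Rin * P.ω * P.μ₁ - P.k w i * w.v i ≤ P.F w i :=
  have hc := hP.Rin_mul_ω_le_cruiseSpeed hw i
  calc P.Rin * P.ω * P.μ₁ - P.k w i * w.v i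
      ≤ P.cruiseSpeed w i * (P.k w i - (P.Phi w i - P.G w i)) - P.k w i * w.v i :=
        sub_le_sub_right (mul_le_mul hc (hP.μ₁_le_k_sub_Phi_sub_G w i) hP.μ₁_pos.le
          ((mul_pos hP.Rin_pos hP.ω_pos).le.trans hc)) _
    _ = P.F w i := by unfold F cruiseSpeed; ring

theorem F_le (hP : P.LongRangeAdmissible) (hw : w ∈ P.dom) (i : Fin n) :
    P.F w i ≤ P.k w i * (P.vmax - w.v i) - P.μ₁ * (P.vmax - P.Rout * P.ω / Real.cos P.Θ) :=
  calc P.F w i = P.k w i * (P.vmax - w.v i) - (P.k w i * (P.vmax - P.cruiseSpeed w i)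
        + P.cruiseSpeed w i * (P.Phi w i - P.G w i)) := by unfold F cruiseSpeed; ring
    _ ≤ P.k w i * (P.vmax - w.v i) - P.μ₁ * (P.vmax - P.cruiseSpeed w i) :=
        sub_le_sub_left (hP.μ₁_mul_vmax_sub_cruiseSpeed_le hw i) _
    _ ≤ P.k w i * (P.vmax - w.v i) - P.μ₁ * (P.vmax - P.Rout * P.ω / Real.cos P.Θ) :=
        sub_le_sub_left (mul_le_mul_of_nonneg_left
          (sub_le_sub_left (hP.cruiseSpeed_le_div_cos_Θ hw i) _) hP.μ₁_pos.le) _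

theorem exists_k_le_on_core (hP : P.LongRangeAdmissible) (h : ℝ) :
    ∃ C, ∀ w ∈ P.core h 0, ∀ i, P.k w i ≤ C := by
  obtain ⟨C, hC⟩ := hP.exists_norm_le_on_core (f := P.k) le_rfl (continuousOn_pi.2 fun i =>
    (hP.contDiffOn_k i).continuousOn.mono core_subset_dom) k_add_turn (h := h)
  exact ⟨C, fun w hw i => (Real.le_norm_self _).trans ((norm_le_pi_norm _ i).trans (hC w hw))⟩

theorem exists_speed_margin (hP : P.LongRangeAdmissible) {w₀ : State n} (hw₀ : w₀ ∈ P.Ω) (h : ℝ) :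
    ∃ ε, 0 < ε ∧ (∀ i, w₀.v i ∈ Icc ε (P.vmax - ε)) ∧ ∀ w ∈ P.core h 0, ∀ i,
      (w.v i = ε → 0 < P.F w i) ∧ (w.v i = P.vmax - ε → P.F w i < 0) := by
  obtain ⟨C, hC⟩ := hP.exists_k_le_on_core h
  have hsmall : ∀ (c : ℝ) {a : ℝ}, 0 < a → ∀ᶠ ε in 𝓝[>] (0 : ℝ), c * ε < a := fun c a ha =>
    (((continuous_const_mul c).tendsto' 0 0 (mul_zero c)).mono_left
      nhdsWithin_le_nhds).eventually_lt_const ha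
  obtain ⟨ε, hε, hlow, hupp, hFlow, hFupp⟩ := (eventually_mem_nhdsWithin.and
    ((eventually_all.2 fun i => hsmall 1 (hw₀.2.2.1 i).1).and
    ((eventually_all.2 fun i => hsmall 1 (sub_pos.2 (hw₀.2.2.1 i).2)).and
    ((hsmall C (mul_pos (mul_pos hP.Rin_pos hP.ω_pos) hP.μ₁_pos)).and
    (hsmall C (mul_pos hP.μ₁_pos (sub_pos.2 hP.Rout_mul_ω_div_cos_Θ_lt_vmax))))))).exists
  have hε : 0 < ε := hε
  refine ⟨ε, hε, fun i => ⟨by linarith [hlow i], by linarith [hupp i]⟩, fun w hw i =>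
    ⟨fun hv => ?_, fun hv => ?_⟩⟩
  · have hF := hP.le_F (core_subset_dom hw) i
    rw [hv] at hF
    linarith [mul_le_mul_of_nonneg_right (hC w hw i) hε.le]
  · have hF := hP.F_le (core_subset_dom hw) i
    rw [hv, sub_sub_cancel] at hF
    linarith [mul_le_mul_of_nonneg_right (hC w hw i) hε.le]

theorem exists_forall_mapsTo_core (hP : P.LongRangeAdmissible) {w₀ : State n} (hw₀ : w₀ ∈ P.Ω) :
    ∃ ε, 0 < ε ∧ ∀ (T : ℝ) (y : ℝ → State n), y 0 = w₀ →
      IsIntegralCurveOn y (fun _ => P.vectorField) (Icc 0 T) → MapsTo y (Icc 0 T) P.Ω →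
      MapsTo y (Icc 0 T) (P.core (P.H w₀) ε) := by
  obtain ⟨ε, hε, hv₀, hF⟩ := hP.exists_speed_margin hw₀ (P.H w₀)
  refine ⟨ε, hε, fun T y hy₀ hy hyΩ => ?_⟩
  have hcore : ∀ t ∈ Icc 0 T, y t ∈ P.core (P.H w₀) 0 := fun t ht => mem_core_zero (hyΩ ht) <|
    hy₀ ▸ hP.antitoneOn_H (convex_Icc 0 T) hy hyΩ (left_mem_Icc.2 (ht.1.trans ht.2)) ht ht.1
  have hv : ∀ i, ∀ t ∈ Icc 0 T, HasDerivWithinAt (fun t => (y t).v i) (P.F (y t) i) (Icc 0 T) t :=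
    fun i t ht => hasDerivWithinAt_v (hy t ht) i
  exact fun t ht => ⟨(hcore t ht).1, fun i =>
    ⟨le_of_forall_eq_deriv_pos (hv i) (hy₀ ▸ (hv₀ i).1)
      (fun t ht => (hF _ (hcore t ht) i).1) t ht,
    le_of_forall_eq_deriv_neg (hv i) (hy₀ ▸ (hv₀ i).2)
      (fun t ht => (hF _ (hcore t ht) i).2) t ht⟩⟩

end LongRangeAdmissible

end Invariance

section GlobalSolution

namespace LongRangeAdmissible

variable {h ε : ℝ}

theorem exists_lipschitzOnWith (hP : P.LongRangeAdmissible) (hε : 0 < ε) :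
    ∃ C, ∀ (I : Set ℝ) (w : ℝ → State n), Convex ℝ I →
      IsIntegralCurveOn w (fun _ => P.vectorField) I → MapsTo w I (P.core h ε) →
      LipschitzOnWith C w I := by
  obtain ⟨C, hC⟩ := hP.exists_norm_le_on_core (h := h) hε.le
    (hP.contDiffOn_vectorField.continuousOn.mono (core_subset_Ω hε)) vectorField_add_turn
  exact ⟨C.toNNReal, fun I w hI hw hwK =>
    hI.lipschitzOnWith_of_nnnorm_hasDerivWithin_le hw fun t ht =>
      NNReal.coe_le_coe.1 ((hC _ (hwK ht)).trans (Real.le_coe_toNNReal C))⟩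

theorem exists_global_solution (hP : P.LongRangeAdmissible) {w₀ : State n} (hw₀ : w₀ ∈ P.Ω) :
    ∃ w : ℝ → State n, w 0 = w₀ ∧ IsIntegralCurveOn w (fun _ => P.vectorField) (Ici 0) ∧
      ∃ ε, 0 < ε ∧ MapsTo w (Ici 0) (P.core (P.H w₀) ε) := by
  obtain ⟨ε, hε, hcore⟩ := hP.exists_forall_mapsTo_core hw₀
  obtain ⟨C, hC⟩ := hP.exists_lipschitzOnWith (h := P.H w₀) hε
  obtain ⟨w, hw₀', hw, hwΩ⟩ := exists_isIntegralCurveOn_Ici isOpen_Ω hP.contDiffOn_vectorField hw₀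
    fun T _ => ⟨P.core (P.H w₀) ε ∩ Metric.closedBall w₀ (C * T),
      (isCompact_closedBall _ _).inter_left hP.isClosed_core,
      inter_subset_left.trans (core_subset_Ω hε), fun t ht y hy₀ hy hyΩ => by
        have hyK := hcore t y hy₀ hy hyΩ
        refine ⟨hyK (right_mem_Icc.2 ht.1), ?_⟩
        rw [Metric.mem_closedBall, ← hy₀]
        refine ((hC _ y (convex_Icc 0 t) hy hyK).dist_le_mul t (right_mem_Icc.2 ht.1) 0
          (left_mem_Icc.2 ht.1)).trans (mul_le_mul_of_nonneg_left ?_ C.coe_nonneg)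
        rw [Real.dist_0_eq_abs, abs_of_nonneg ht.1]
        exact ht.2⟩
  exact ⟨w, hw₀', hw, ε, hε, fun t ht => hcore t w hw₀' (hw.mono Icc_subset_Ici_self)
    (hwΩ.mono_left Icc_subset_Ici_self) (right_mem_Icc.2 ht)⟩

end LongRangeAdmissible

end GlobalSolution

section Asymptotics

theorem Hdot_add_turn (w : State n) (m : Fin n → ℤ) : P.Hdot (w + turn m) = P.Hdot w := by
  simp only [Hdot, s_add_turn, k_add_turn, G_add_turn, M_add_turn, angSpeed_add_turn]

namespace LongRangeAdmissible

theorem continuousOn_Hdot (hP : P.LongRangeAdmissible) : ContinuousOn P.Hdot P.dom := by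
  refine continuousOn_finsetSum _ fun i _ => ?_
  have hk := (hP.contDiffOn_k i).continuousOn
  have hG := (hP.contDiffOn_G i).continuousOn
  have hM := (hP.contDiffOn_M i).continuousOn
  have hω := (hP.contDiffOn_angSpeed i).continuousOn
  fun_prop

theorem sq_add_sq_le_neg_Hdot (hP : P.LongRangeAdmissible) {w : State n} (hw : w ∈ P.dom)
    (i : Fin n) :
    P.μ₁ * (angSpeed w i - P.ω) ^ 2 + P.μ₂ * Real.sin (w.s i) ^ 2 ≤ -P.Hdot w := by
  have hμ₁ := hP.μ₁_pos
  have hμ₂ := hP.μ₂_pos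
  exact (Finset.single_le_sum (f := fun i => P.μ₁ * (angSpeed w i - P.ω) ^ 2
    + P.μ₂ * Real.sin (w.s i) ^ 2) (fun i _ => by positivity) (Finset.mem_univ i)).trans
    (le_neg_of_le_neg (hP.Hdot_le hw))

variable {w : ℝ → State n} {h ε : ℝ}

theorem tendsto_zero_of_hasDerivWithinAt (hP : P.LongRangeAdmissible) (hε : 0 < ε)
    (hw : IsIntegralCurveOn w (fun _ => P.vectorField) (Ici 0))
    (hwK : MapsTo w (Ici 0) (P.core h ε)) {x : ℝ → ℝ} {x' : State n → ℝ} {l : ℝ}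
    (hx : ∀ t ∈ Ici 0, HasDerivWithinAt x (x' (w t)) (Ici 0) t) (hl : Tendsto x atTop (𝓝 l))
    (hcont : ContinuousOn x' P.Ω) (hturn : ∀ w m, x' (w + turn m) = x' w) :
    Tendsto (fun t => x' (w t)) atTop (𝓝 0) := by
  obtain ⟨C, hC⟩ := hP.exists_lipschitzOnWith (h := h) hε
  exact tendsto_zero_of_tendsto_of_uniformContinuousOn hx hl
    ((hP.uniformContinuousOn_core hε.le (hcont.mono (core_subset_Ω hε)) hturn).comp
      (hC _ w (convex_Ici 0) hw hwK).uniformContinuousOn hwK)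

theorem tendsto_Hdot (hP : P.LongRangeAdmissible) (hε : 0 < ε)
    (hw : IsIntegralCurveOn w (fun _ => P.vectorField) (Ici 0))
    (hwK : MapsTo w (Ici 0) (P.core h ε)) : Tendsto (fun t => P.Hdot (w t)) atTop (𝓝 0) := by
  have hwΩ : MapsTo w (Ici 0) P.Ω := hwK.mono_right (core_subset_Ω hε)
  obtain ⟨l, hl⟩ := exists_tendsto_of_antitoneOn_Ici (hP.antitoneOn_H (convex_Ici 0) hw hwΩ)
    ⟨0, forall_mem_image.2 fun t ht => hP.H_nonneg (Ω_subset_dom (hwΩ ht))⟩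
  exact hP.tendsto_zero_of_hasDerivWithinAt hε hw hwK
    (fun t ht => hP.hasDerivWithinAt_H (hw t ht) (hwΩ ht)) hl
    (hP.continuousOn_Hdot.mono Ω_subset_dom) Hdot_add_turn

theorem tendsto_angSpeed (hP : P.LongRangeAdmissible) (hwd : MapsTo w (Ici 0) P.dom)
    (hH : Tendsto (fun t => P.Hdot (w t)) atTop (𝓝 0)) (i : Fin n) :
    Tendsto (fun t => angSpeed (w t) i) atTop (𝓝 P.ω) := by
  refine tendsto_sub_nhds_zero_iff.1
    (tendsto_zero_of_mul_sq_le hP.μ₁_pos ?_ (neg_zero (G := ℝ) ▸ hH.neg))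
  filter_upwards [eventually_ge_atTop 0] with t ht
  exact (le_add_of_nonneg_right (mul_nonneg hP.μ₂_pos.le (sq_nonneg _))).trans
    (hP.sq_add_sq_le_neg_Hdot (hwd ht) i)

theorem tendsto_s (hP : P.LongRangeAdmissible) (hwd : MapsTo w (Ici 0) P.dom)
    (hH : Tendsto (fun t => P.Hdot (w t)) atTop (𝓝 0)) (i : Fin n) :
    Tendsto (fun t => (w t).s i) atTop (𝓝 0) := by
  have hsin : Tendsto (fun t => Real.sin ((w t).s i)) atTop (𝓝 0) := by
    refine tendsto_zero_of_mul_sq_le hP.μ₂_pos ?_ (neg_zero (G := ℝ) ▸ hH.neg)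
    filter_upwards [eventually_ge_atTop 0] with t ht
    exact (le_add_of_nonneg_left (mul_nonneg hP.μ₁_pos.le (sq_nonneg _))).trans
      (hP.sq_add_sq_le_neg_Hdot (hwd ht) i)
  refine ((Real.continuous_arcsin.tendsto' 0 0 Real.arcsin_zero).comp hsin).congr' ?_
  filter_upwards [eventually_ge_atTop 0] with t ht
  have hs : -P.Θ < (w t).s i ∧ (w t).s i < P.Θ := (hwd ht).2.1 i
  exact Real.arcsin_sin (by linarith [hP.Θ_lt]) (by linarith [hP.Θ_lt])

theorem tendsto_v_div_r (hP : P.LongRangeAdmissible) (hwd : MapsTo w (Ici 0) P.dom)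
    (hω : ∀ i, Tendsto (fun t => angSpeed (w t) i) atTop (𝓝 P.ω))
    (hs : ∀ i, Tendsto (fun t => (w t).s i) atTop (𝓝 0)) (i : Fin n) :
    Tendsto (fun t => (w t).v i / (w t).r i) atTop (𝓝 P.ω) := by
  have hcos := (Real.continuous_cos.tendsto' 0 1 Real.cos_zero).comp (hs i)
  refine (div_one P.ω ▸ (hω i).div hcos one_ne_zero).congr' ?_
  filter_upwards [eventually_ge_atTop 0] with t ht
  exact mul_div_cancel_right₀ _ (hP.cos_pos (hwd ht) i).ne'

theorem tendsto_sdot (hP : P.LongRangeAdmissible) (hε : 0 < ε)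
    (hw : IsIntegralCurveOn w (fun _ => P.vectorField) (Ici 0))
    (hwK : MapsTo w (Ici 0) (P.core h ε)) (hs : ∀ i, Tendsto (fun t => (w t).s i) atTop (𝓝 0))
    (i : Fin n) : Tendsto (fun t => P.sdot (w t) i) atTop (𝓝 0) :=
  hP.tendsto_zero_of_hasDerivWithinAt (x' := fun w => P.sdot w i) hε hw hwK
    (fun t ht => hasDerivWithinAt_s (hw t ht) i) (hs i)
    (continuousOn_pi.1 hP.contDiffOn_sdot.continuousOn i)
    fun w m => congrFun (sdot_add_turn w m) i

theorem tendsto_deriv_s (hP : P.LongRangeAdmissible) (hε : 0 < ε)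
    (hw : IsIntegralCurveOn w (fun _ => P.vectorField) (Ici 0))
    (hwK : MapsTo w (Ici 0) (P.core h ε)) (hs : ∀ i, Tendsto (fun t => (w t).s i) atTop (𝓝 0))
    (i : Fin n) : Tendsto (deriv fun t => (w t).s i) atTop (𝓝 0) := by
  refine (hP.tendsto_sdot hε hw hwK hs i).congr' ?_
  filter_upwards [eventually_gt_atTop 0] with t ht
  exact ((hasDerivWithinAt_s (hw t ht.le) i).hasDerivAt (Ici_mem_nhds ht)).deriv.symm

theorem tendsto_F_div_r (hP : P.LongRangeAdmissible) (hε : 0 < ε)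
    (hw : IsIntegralCurveOn w (fun _ => P.vectorField) (Ici 0))
    (hwK : MapsTo w (Ici 0) (P.core h ε)) (hs : ∀ i, Tendsto (fun t => (w t).s i) atTop (𝓝 0))
    (hv : ∀ i, Tendsto (fun t => (w t).v i / (w t).r i) atTop (𝓝 P.ω)) (i : Fin n) :
    Tendsto (fun t => P.F (w t) i / (w t).r i) atTop (𝓝 0) := by
  have hr : ∀ w ∈ P.Ω, w.r i ≠ 0 := fun w hw => (hP.r_pos (Ω_subset_dom hw) i).ne'
  have hF := continuousOn_pi.1 (hP.contDiffOn_F.continuousOn.mono Ω_subset_dom) i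
  have hderiv : ∀ t ∈ Ici 0, HasDerivWithinAt (fun t => (w t).v i / (w t).r i)
      (P.F (w t) i / (w t).r i + ((w t).v i / (w t).r i) ^ 2 * Real.sin ((w t).s i)) (Ici 0) t :=
    fun t ht => by
      have hrt := hr _ (core_subset_Ω hε (hwK ht))
      refine ((hasDerivWithinAt_v (hw t ht) i).div (hasDerivWithinAt_r (hw t ht) i)
        hrt).congr_deriv ?_
      field_simp
      ring
  have hsum := hP.tendsto_zero_of_hasDerivWithinAt hε hw hwK
    (x' := fun w => P.F w i / w.r i + (w.v i / w.r i) ^ 2 * Real.sin (w.s i)) hderiv (hv i)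
    (by fun_prop (disch := assumption))
    fun w m => by simp only [r_add_turn, s_add_turn, v_add_turn, F_add_turn]
  have hcentripetal := ((hv i).pow 2).mul ((Real.continuous_sin.tendsto' 0 0 Real.sin_zero).comp
    (hs i))
  simpa only [Function.comp_apply, add_sub_cancel_right, mul_zero, sub_zero] using
    hsum.sub hcentripetal

theorem tendsto_F (hP : P.LongRangeAdmissible) (hwd : MapsTo w (Ici 0) P.dom) (i : Fin n)
    (hF : Tendsto (fun t => P.F (w t) i / (w t).r i) atTop (𝓝 0)) :
    Tendsto (fun t => P.F (w t) i) atTop (𝓝 0) := by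
  have hr : ∀ᶠ t in atTop, |(w t).r i| ≤ P.Rout := by
    filter_upwards [eventually_ge_atTop 0] with t ht
    rw [abs_of_pos (hP.r_pos (hwd ht) i)]
    exact ((hwd ht).1 i).2.le
  refine (bdd_le_mul_tendsto_zero' P.Rout hr hF).congr' ?_
  filter_upwards [eventually_ge_atTop 0] with t ht
  exact mul_div_cancel₀ _ (hP.r_pos (hwd ht) i).ne'

end LongRangeAdmissible

end Asymptotics

section ClosedLoop

theorem abs_δ_le (w : State n) (i : Fin n) : |P.δ w i| ≤ Real.pi / 2 :=
  abs_le.2 ⟨(Real.neg_pi_div_two_lt_arctan _).le, (Real.arctan_lt_pi_div_two _).le⟩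

theorem IsSolutionOn.mono {w : ℝ → State n} {I J : Set ℝ} (hw : P.IsSolutionOn I w) (hJI : J ⊆ I) :
    P.IsSolutionOn J w := fun t ht =>
  ⟨(hw t (hJI ht)).1, (hw t (hJI ht)).2.mono hJI⟩

namespace LongRangeAdmissible

theorem exists_monotone_norm_F_le (hP : P.LongRangeAdmissible) :
    ∃ C : ℝ → ℝ, Monotone C ∧ (∀ c, 0 ≤ C c) ∧ ∀ w ∈ P.Ω, ‖P.F w‖ ≤ C (P.H w) := by
  refine exists_monotone_forall_le fun c => ?_
  obtain ⟨C, hC⟩ := hP.exists_norm_le_on_core (h := c) le_rfl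
    (hP.contDiffOn_F.continuousOn.mono core_subset_dom) F_add_turn
  exact ⟨C, forall_mem_image.2 fun w hw => hC w (mem_core_zero hw.1 hw.2)⟩

theorem eqOn_Ico_of_isSolutionOn (hP : P.LongRangeAdmissible) {w y : ℝ → State n} {a b : ℝ}
    (hw : P.IsSolutionOn (Ico a b) w) (hy : P.IsSolutionOn (Ico a b) y) (ha : w a = y a) :
    EqOn w y (Ico a b) := by
  rw [hP.isSolutionOn_iff] at hw hy
  intro t ht
  have hsub : Icc a t ⊆ Ico a b := Icc_subset_Ico_right ht.2
  exact eqOn_Icc_of_isIntegralCurveOn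
    (locallyLipschitzOn_of_contDiffOn isOpen_Ω hP.contDiffOn_vectorField) (hw.1.mono hsub)
    (hw.2.mono_left hsub) (hy.1.mono hsub) (hy.2.mono_left hsub) ha (right_mem_Icc.2 ht.1)

end LongRangeAdmissible

end ClosedLoop

end Params

end RingRoad

theorem theorem1_general {n : ℕ} (P : RingRoad.Params n) (hP : P.LongRangeAdmissible) :
    ∃ P₁ : ℝ → ℝ, MonotoneOn P₁ (Ici 0) ∧ MapsTo P₁ (Ici 0) (Ici 0) ∧
      ∀ w₀ ∈ P.Ω, ∃ w : ℝ → RingRoad.State n,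
        (w 0 = w₀ ∧ P.IsSolutionOn (Ici 0) w) ∧
        (∀ T : ℝ, 0 < T → ∀ y : ℝ → RingRoad.State n,
          y 0 = w₀ → P.IsSolutionOn (Ico 0 T) y → EqOn y w (Ico 0 T)) ∧
        (∀ i, Tendsto (fun t => (w t).s i) atTop (𝓝 0)) ∧
        (∀ i, Tendsto (fun t => (w t).v i / (w t).r i) atTop (𝓝 P.ω)) ∧
        (∀ i, Tendsto (deriv fun t => (w t).s i) atTop (𝓝 0)) ∧
        (∀ i, Tendsto (fun t => P.F (w t) i) atTop (𝓝 0)) ∧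
        ∀ t, 0 ≤ t → ∀ i, |P.F (w t) i| + |P.δ (w t) i| ≤ P₁ (P.H w₀) := by
  obtain ⟨C, hCmono, hC₀, hC⟩ := hP.exists_monotone_norm_F_le
  refine ⟨fun h => C h + Real.pi / 2, (hCmono.add_const _).monotoneOn _,
    fun h _ => add_nonneg (hC₀ h) Real.pi_div_two_pos.le, fun w₀ hw₀ => ?_⟩
  obtain ⟨w, rfl, hw, ε, hε, hwK⟩ := hP.exists_global_solution hw₀
  have hwΩ : MapsTo w (Ici 0) P.Ω := hwK.mono_right (RingRoad.Params.core_subset_Ω hε)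
  have hwd : MapsTo w (Ici 0) P.dom := hwK.mono_right RingRoad.Params.core_subset_dom
  have hsol : P.IsSolutionOn (Ici 0) w := hP.isSolutionOn_iff.2 ⟨hw, hwΩ⟩
  have hHdot := hP.tendsto_Hdot hε hw hwK
  have hs := hP.tendsto_s hwd hHdot
  have hv := hP.tendsto_v_div_r hwd (hP.tendsto_angSpeed hwd hHdot) hs
  refine ⟨w, ⟨rfl, hsol⟩, fun T _ y hy₀ hy => ?_, hs, hv, hP.tendsto_deriv_s hε hw hwK hs,
    fun i => hP.tendsto_F hwd i (hP.tendsto_F_div_r hε hw hwK hs hv i), fun t ht i => ?_⟩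
  · exact hP.eqOn_Ico_of_isSolutionOn hy (hsol.mono Ico_subset_Ici_self) hy₀
  · have hF : |P.F (w t) i| ≤ C (P.H (w t)) := (norm_le_pi_norm _ i).trans (hC _ (hwΩ ht))
    exact add_le_add (hF.trans (hCmono (hwK ht).1.2)) (P.abs_δ_le _ i)

theorem theorem1 {n : ℕ} (P : RingRoad.Params n) (hP : P.Admissible) :
    ∃ P₁ : ℝ → ℝ, MonotoneOn P₁ (Ici 0) ∧ MapsTo P₁ (Ici 0) (Ici 0) ∧
      ∀ w₀ ∈ P.Ω, ∃ w : ℝ → RingRoad.State n,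
        (w 0 = w₀ ∧ P.IsSolutionOn (Ici 0) w) ∧
        (∀ T : ℝ, 0 < T → ∀ y : ℝ → RingRoad.State n,
          y 0 = w₀ → P.IsSolutionOn (Ico 0 T) y → EqOn y w (Ico 0 T)) ∧
        (∀ i, Tendsto (fun t => (w t).s i) atTop (𝓝 0)) ∧
        (∀ i, Tendsto (fun t => (w t).v i / (w t).r i) atTop (𝓝 P.ω)) ∧
        (∀ i, Tendsto (deriv fun t => (w t).s i) atTop (𝓝 0)) ∧
        (∀ i, Tendsto (fun t => P.F (w t) i) atTop (𝓝 0)) ∧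
        ∀ t, 0 ≤ t → ∀ i, |P.F (w t) i| + |P.δ (w t) i| ≤ P₁ (P.H w₀) :=
  theorem1_general P hP.longRangeAdmissible
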